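/- **Setting.** For $k\in\mathbb N$ let $p=p_k\ge 1$, $n_s\ge 1$ and $n_t\ge p$ be integers, let $F=F_k$ be a probability law of $(x,y)\in\mathbb R^{p}\times\mathbb R$ with square-integrable coordinates, and let $\beta=\beta_k\in\mathbb R^{p}$ (all these objects, and all those below except $q$ and $\tau$, may depend on $k$; a single experiment is the case of a constant sequence). Assume: - (A1) $y=x^T\beta+u$; - (A2) $\mathbb E(u\,x)=0$; - (A3) no regressor $x_i$ with $\beta_i\neq0$ is almost surely a linear combination of the other regressors; - (A4) the observations of the training set $(X_t,Y_t)$ (size $n_t$) and of the test set $(X_s,Y_s)$ (size $n_s$) are all independent with law $F$. Assume also that there are constants $q>1$ and $\tau>0$, not depending on $k$, with $$\Big(\int (y-x^Tb)^{2q}\,dF\Big)^{1/q}\le\tau\int (y-x^Tb)^2\,dF\qquad\text{for all } b\in\mathbb R^{p}.$$ Let $b_{train}$ be an OLS estimator, i.e. a minimizer of $\frac1{n_t}\|Y_t-X_tb\|_2^2$. For each $\lambda$ in a (possibly data-dependent) list of penalties $\lambda\ge0$ that contains $0$, let $b_\lambda$ minimize $\frac1{n_t}\|Y_t-X_tb\|_2^2+\lambda\|b\|_1$,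 with $b_0=b_{train}$, and let $b_{Lasso}$ be a member of the list $\{b_\lambda\}$ that minimizes the test error $\frac1{n_s}\|Y_s-X_sb\|_2^2$. Put $e_t=Y_t-X_tb_{train}$, $e_s=Y_s-X_sb_{train}$, and let $\rho$ be the minimal eigenvalue of $\frac1{n_s}X_s^TX_s$. For $\varpi\in(0,1)$ put $$\epsilon=\frac1{n_t}\Big[p\ln\frac{n_t}{p}+p-\ln\frac1{n_t}\Big],\qquad \varsigma=\frac{2^{1/q}\,\tau\,R(b_{train})}{(1-\varpi)^{1/q}\,n_s^{1-1/q}},\qquad R(b)=\int (y-x^Tb)^2\,dF .$$ **Theorem 3.** (i) For every $\varpi\in(0,1)$, with probability at least $\varpi(1-1/n_t)$, $$\|b_{train}-b_{Lasso}\|_2\le \sqrt{\left|\frac1{\rho n_t}\frac{\|e_t\|_2^2}{1-\sqrt\epsilon}-\frac1{\rho n_s}\|e_s\|_2^2\right|} +\sqrt{\frac4{\rho n_s}\|e_s^TX_s\|_\infty\|b_{train}\|_1} +\Big(\frac{\varsigma}{\rho}\Big)^{1/2},$$ where the right-hand side is read as $+\infty$ if $\rho=0$. (ii) Suppose that, along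 the sequence $k\to\infty$, the second moments $\mathbb E y^2$ are bounded (they equal $1$ for standardized variables), the minimal eigenvalues of $\mathbb E(xx^T)$ are bounded away from $0$, and $p/\min\{n_t,n_s\}\to0$ (here $p$ may be fixed or grow). Then OLS and validated Lasso are consistent in the Euclidean norm: $\|b_{train}-\beta\|_2\to0$ and $\|b_{Lasso}-\beta\|_2\to0$ in probability. -/

import Mathlib

open MeasureTheory ProbabilityTheory Filter Topology Matrix

noncomputable section

namespace ValidatedLasso

/-- An observation `(x, y)`: `p` regressors and one response. -/
abbrev Obs (p : ℕ) : Type := (Fin p → ℝ) × ℝ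

/-- Coefficient vectors, with the Euclidean norm. -/
abbrev Coef (p : ℕ) : Type := EuclideanSpace ℝ (Fin p)

/-- The disturbance `u = y - xᵀ β`, so that `y = xᵀ β + u`. -/
def disturbance {p : ℕ} (β : Coef p) (z : Obs p) : ℝ := z.2 - z.1 ⬝ᵥ β.ofLp

/-- The squared loss `(y - xᵀ b)²`. -/
def loss {p : ℕ} (b : Coef p) (z : Obs p) : ℝ := (z.2 - z.1 ⬝ᵥ b.ofLp) ^ 2

/-- The population risk `∫ (y - xᵀ b)² dF(x, y)`. -/
def risk {p : ℕ} (F : Measure (Obs p)) (b : Coef p) : ℝ := ∫ z, loss b z ∂F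

/-- The `n × p` matrix of regressors of a sample. -/
def design {n p : ℕ} (z : Fin n → Obs p) : Matrix (Fin n) (Fin p) ℝ :=
  Matrix.of fun i j => (z i).1 j

/-- The residual vector `e = Y - X b`. -/
def resid {n p : ℕ} (z : Fin n → Obs p) (b : Coef p) : Fin n → ℝ :=
  fun i => (z i).2 - (design z *ᵥ b.ofLp) i

/-- The empirical risk `(1/n) ‖Y - X b‖₂²`. -/
def empRisk {n p : ℕ} (z : Fin n → Obs p) (b : Coef p) : ℝ :=
  (1 / (n : ℝ)) * ∑ i, resid z b i ^ 2

/-- The norm `‖b‖₁`. -/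
def l1norm {p : ℕ} (b : Coef p) : ℝ := ∑ j, |b j|

/-- `b` is a least squares (OLS) estimate from the sample `z`. -/
def IsOLS {n p : ℕ} (z : Fin n → Obs p) (b : Coef p) : Prop :=
  ∀ b' : Coef p, empRisk z b ≤ empRisk z b'

/-- `b` is a Lasso estimate with penalty `lam` from the sample `z`. -/
def IsLasso {n p : ℕ} (z : Fin n → Obs p) (lam : ℝ) (b : Coef p) : Prop :=
  ∀ b' : Coef p, empRisk z b + lam * l1norm b ≤ empRisk z b' + lam * l1norm b'

/-- `bLasso` is the Lasso estimate tuned by validation: for every penalty in the list `Lam` (which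
contains `0`) a Lasso estimate is computed from the training sample `zt`, the one for the penalty
`0` being the unpenalized estimate `bTrain`, and an estimate of this list with the smallest
empirical risk on the test sample `zs` is taken. -/
def IsValidatedLasso {nt ns p : ℕ} (zt : Fin nt → Obs p) (zs : Fin ns → Obs p) (Lam : Set ℝ)
    (bTrain bLasso : Coef p) : Prop :=
  (0 : ℝ) ∈ Lam ∧ (∀ lam ∈ Lam, 0 ≤ lam) ∧
  ∃ path : ℝ → Coef p, path 0 = bTrain ∧ (∀ lam ∈ Lam, IsLasso zt lam (path lam)) ∧
    ∃ lamHat ∈ Lam, bLasso = path lamHat ∧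
      ∀ lam ∈ Lam, empRisk zs (path lamHat) ≤ empRisk zs (path lam)

/-- The sample second moment matrix `(1/n) Xᵀ X`. -/
def gram {n p : ℕ} (z : Fin n → Obs p) : Matrix (Fin p) (Fin p) ℝ :=
  (1 / (n : ℝ)) • ((design z)ᵀ * design z)

theorem gram_isHermitian {n p : ℕ} (z : Fin n → Obs p) : (gram z).IsHermitian := by
  simp [Matrix.IsHermitian, gram, Matrix.conjTranspose_eq_transpose_of_trivial,
    Matrix.transpose_mul]

/-- The population second moment matrix `E[x xᵀ]`. -/
def popGram {p : ℕ} (F : Measure (Obs p)) : Matrix (Fin p) (Fin p) ℝ :=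
  Matrix.of fun i j => ∫ z, z.1 i * z.1 j ∂F

theorem popGram_isHermitian {p : ℕ} (F : Measure (Obs p)) : (popGram F).IsHermitian := by
  ext i j
  simp [popGram, mul_comm]

/-- The minimal eigenvalue of a symmetric matrix (of size at least `1`). -/
def minEigenvalue {p : ℕ} {A : Matrix (Fin p) (Fin p) ℝ} (hA : A.IsHermitian) : ℝ :=
  ⨅ j, hA.eigenvalues j

/-- The linear model `y = xᵀ β + u` with square-integrable variables, for the population law `F`
of `(x, y)`. -/
structure IsLinearModel {p : ℕ} (F : Measure (Obs p)) (β : Coef p) : Prop where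
  memLp_regressor : ∀ j, MemLp (fun z : Obs p => z.1 j) 2 F
  memLp_response : MemLp (fun z : Obs p => z.2) 2 F
  /-- Exogeneity: `E[u x] = 0`. -/
  exogenous : ∀ j, ∫ z, disturbance β z * z.1 j ∂F = 0
  /-- No regressor with a non-zero coefficient is a linear combination of the others. -/
  unique : ∀ j, β j ≠ 0 →
    ¬ ∃ c : Fin p → ℝ, c j = 0 ∧ ∀ᵐ z ∂F, z.1 j = z.1 ⬝ᵥ c

/-- All observations of the training and the test sample are independent with the law `F`. -/
structure IsIIDTrainTest {Ω : Type*} [MeasurableSpace Ω] {nt ns p : ℕ} (F : Measure (Obs p))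
    (Zt : Fin nt → Ω → Obs p) (Zs : Fin ns → Ω → Obs p) (μ : Measure Ω) : Prop where
  law_train : ∀ i, HasLaw (Zt i) F μ
  law_test : ∀ i, HasLaw (Zs i) F μ
  indep : iIndepFun (Sum.elim Zt Zs) μ

/-- `τ` bounds the ratio `(∫ Loss^q dF)^(1/q) / ∫ Loss dF` over all linear models `b`. -/
def TailRatioLE {p : ℕ} (q τ : ℝ) (F : Measure (Obs p)) : Prop :=
  ∀ b : Coef p,
    eLpNorm (loss b) (ENNReal.ofReal q) F ≤ ENNReal.ofReal τ * eLpNorm (loss b) 1 F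

/-- `ε = (1/n_t) (h ln(n_t/h) + h - ln η)`, with the VC dimension `h = p` of the linear model
and `η = 1/n_t`. -/
def vcEps (nt p : ℕ) : ℝ :=
  (1 / (nt : ℝ)) * (p * Real.log ((nt : ℝ) / p) + p - Real.log (1 / (nt : ℝ)))

/-- `ς = 2^(1/q) τ r / ((1 - ϖ)^(1/q) n_s^(1 - 1/q))`, where `r` is the expected loss. -/
def varsigma (q τ ϖ : ℝ) (ns : ℕ) (r : ℝ) : ℝ :=
  ((2 : ℝ) ^ (1 / q) * τ * r) / ((1 - ϖ) ^ (1 / q) * (ns : ℝ) ^ (1 - 1 / q))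

/-- The right-hand side of the bound: `sT` and `sS` are the squared lengths of the residuals of
`bTrain` on the training and the test sample, `m` is `‖e_sᵀ X_s‖_∞`, `l` is `‖bTrain‖₁`. -/
def lassoBound (nt ns : ℕ) (ε ς ρ sT sS m l : ℝ) : ℝ :=
  Real.sqrt |1 / (ρ * nt) * (sT / (1 - Real.sqrt ε)) - 1 / (ρ * ns) * sS|
    + Real.sqrt (4 / (ρ * ns) * m * l) + Real.sqrt (ς / ρ)

end ValidatedLasso

end

namespace ValidatedLasso

/-! The finite-sample bound is deterministic once ρ > 0. Validation gives `bLasso` a test error no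
larger than that of `bTrain`, and penalization gives it no larger ℓ¹ norm. Expanding the test error
around `bTrain` then bounds ‖X_s(bTrain − bLasso)‖² by 4‖e_sᵀX_s‖_∞‖bTrain‖₁, so the middle square
root alone dominates the distance (`IsValidatedLasso.norm_sub_le`).

Consistency rests on a one-sided uniform law: with high probability, empRisk b ≥ risk b − η(risk b +
1) for all b at once (`IsLinearModel.measure_exists_empRisk_lt_le`). Truncating the loss only lowers
the empirical risk, and the moment ratio τ makes the mean lost to truncation small uniformly in b.
Divided by √(risk b + 1), all residuals are inner products of unit-ball vectors with one feature
vector whose squared norm has mean at most p + 1 (`IsLinearModel.exists_whitening`). Symmetrization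
and contraction (`integral_sup'_empirical_le`) then give deviations of order K√((p + 1)/n) at
truncation level K². Upper deviations are needed at β only.

By exogeneity the excess risk is the quadratic form of E[xxᵀ] at b − β, so small excess risk means
small Euclidean error. For OLS, comparison with β on the training sample suffices. For the Lasso the
comparison is made on the test sample, where uniformity allows `bLasso` to depend on that sample.
That `bTrain` is nearly as good as β there follows from independence of the two samples and Markov's
inequality (`measure_cross_le`). -/

theorem design_mulVec_apply {n p : ℕ} (z : Fin n → Obs p) (v : Fin p → ℝ) (i : Fin n) :
    (design z *ᵥ v) i = (z i).1 ⬝ᵥ v := rfl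

theorem resid_apply {n p : ℕ} (z : Fin n → Obs p) (b : Coef p) (i : Fin n) :
    resid z b i = (z i).2 - (z i).1 ⬝ᵥ b.ofLp := rfl

theorem empRisk_eq_sum_loss {n p : ℕ} (z : Fin n → Obs p) (b : Coef p) :
    empRisk z b = (1 / (n : ℝ)) * ∑ i, loss b (z i) := rfl

/-! ### Quadratic forms and the deterministic comparison of Lasso with OLS -/

theorem minEigenvalue_le {p : ℕ} {A : Matrix (Fin p) (Fin p) ℝ} (hA : A.IsHermitian) (j : Fin p) :
    minEigenvalue hA ≤ hA.eigenvalues j :=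
  ciInf_le (Set.finite_range _).bddBelow j

theorem quadraticForm_eq_sum_eigenvalues {p : ℕ} {A : Matrix (Fin p) (Fin p) ℝ}
    (hA : A.IsHermitian) (v : Coef p) :
    v.ofLp ⬝ᵥ (A *ᵥ v.ofLp) =
      ∑ j, hA.eigenvalues j * (inner ℝ (hA.eigenvectorBasis j) v) ^ 2 := by
  have h1 : v.ofLp ⬝ᵥ (A *ᵥ v.ofLp) = inner ℝ v (Matrix.toEuclideanLin A v) := by
    simp [PiLp.inner_apply, dotProduct, Matrix.toLpLin_apply, mul_comm]
  rw [h1, ← (hA.eigenvectorBasis).sum_inner_mul_inner]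
  refine Finset.sum_congr rfl fun j _ => ?_
  have hsym := (Matrix.isSymmetric_toEuclideanLin_iff.mpr hA)
  have h2 : Matrix.toEuclideanLin A (hA.eigenvectorBasis j)
      = hA.eigenvalues j • hA.eigenvectorBasis j := by
    have := hA.mulVec_eigenvectorBasis j
    ext i
    simpa [Matrix.toLpLin_apply] using congrFun this i
  rw [← hsym, h2, inner_smul_left, real_inner_comm]
  simp
  ring

theorem minEigenvalue_mul_norm_sq_le {p : ℕ} {A : Matrix (Fin p) (Fin p) ℝ}
    (hA : A.IsHermitian) (v : Coef p) :
    minEigenvalue hA * ‖v‖ ^ 2 ≤ v.ofLp ⬝ᵥ (A *ᵥ v.ofLp) := by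
  rw [quadraticForm_eq_sum_eigenvalues hA, ← hA.eigenvectorBasis.sum_sq_norm_inner_right v,
    Finset.mul_sum]
  refine Finset.sum_le_sum fun j _ => ?_
  rw [Real.norm_eq_abs, sq_abs]
  exact mul_le_mul_of_nonneg_right (minEigenvalue_le hA j) (sq_nonneg _)

theorem quadraticForm_gram {n p : ℕ} (z : Fin n → Obs p) (v : Fin p → ℝ) :
    v ⬝ᵥ (gram z *ᵥ v) = (1 / (n : ℝ)) * ∑ i, ((z i).1 ⬝ᵥ v) ^ 2 := by
  rw [gram, Matrix.smul_mulVec, dotProduct_smul, ← Matrix.mulVec_mulVec,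
    Matrix.dotProduct_mulVec, Matrix.vecMul_transpose, smul_eq_mul]
  congr 1
  simp only [dotProduct, sq]
  rfl

/-- Expansion of the residual sum of squares around `b`. -/
theorem sum_resid_sq_expand {n p : ℕ} (z : Fin n → Obs p) (b b' : Coef p) :
    ∑ i, resid z b' i ^ 2 = ∑ i, resid z b i ^ 2
      + 2 * ((resid z b ᵥ* design z) ⬝ᵥ (b - b').ofLp)
      + ∑ i, ((z i).1 ⬝ᵥ (b - b').ofLp) ^ 2 := by
  rw [← Matrix.dotProduct_mulVec]
  simp only [dotProduct, design_mulVec_apply]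
  rw [Finset.mul_sum, ← Finset.sum_add_distrib, ← Finset.sum_add_distrib]
  refine Finset.sum_congr rfl fun i _ => ?_
  have : resid z b' i = resid z b i + (z i).1 ⬝ᵥ (b - b').ofLp := by
    simp only [resid_apply, WithLp.ofLp_sub, dotProduct_sub]
    ring
  rw [this]
  simp only [dotProduct]
  ring

theorem abs_dotProduct_le_norm_mul_l1norm {p : ℕ} (w : Fin p → ℝ) (v : Coef p) :
    |w ⬝ᵥ v.ofLp| ≤ ‖w‖ * l1norm v := by
  refine (Finset.abs_sum_le_sum_abs _ _).trans ?_
  rw [l1norm, Finset.mul_sum]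
  refine Finset.sum_le_sum fun j _ => ?_
  rw [abs_mul]
  exact mul_le_mul_of_nonneg_right (norm_le_pi_norm w j) (abs_nonneg _)

theorem l1norm_sub_le {p : ℕ} (b b' : Coef p) : l1norm (b - b') ≤ l1norm b + l1norm b' := by
  rw [l1norm, l1norm, l1norm, ← Finset.sum_add_distrib]
  exact Finset.sum_le_sum fun j _ => abs_sub _ _

theorem IsLasso.isOLS {n p : ℕ} {z : Fin n → Obs p} {b : Coef p} (h : IsLasso z 0 b) :
    IsOLS z b := fun b' => by simpa using h b'

/-- OLS already has the least empirical risk, so a penalized minimizer can only beat it through the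
penalty. -/
theorem IsLasso.l1norm_le {n p : ℕ} {z : Fin n → Obs p} {lam : ℝ} {b b' : Coef p}
    (hlam : 0 < lam) (h : IsLasso z lam b) (h' : IsOLS z b') : l1norm b ≤ l1norm b' := by
  have h1 := h b'
  have h2 := h' b
  exact le_of_mul_le_mul_left (by linarith) hlam

/-- At penalty 0 minimizers need not be unique, and the bound holds there because the path starts at
`bTrain` itself. -/
theorem IsValidatedLasso.l1norm_le {nt ns p : ℕ} {zt : Fin nt → Obs p} {zs : Fin ns → Obs p}
    {Lam : Set ℝ} {bTrain bLasso : Coef p} (h : IsValidatedLasso zt zs Lam bTrain bLasso) :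
    l1norm bLasso ≤ l1norm bTrain := by
  obtain ⟨h0, hnn, path, hp0, hpath, lamHat, hmem, rfl, -⟩ := h
  rcases (hnn _ hmem).eq_or_lt with h | h
  · rw [← h, hp0]
  · exact (hpath _ hmem).l1norm_le h (hp0 ▸ (hpath 0 h0).isOLS)

theorem IsValidatedLasso.empRisk_le {nt ns p : ℕ} {zt : Fin nt → Obs p} {zs : Fin ns → Obs p}
    {Lam : Set ℝ} {bTrain bLasso : Coef p} (h : IsValidatedLasso zt zs Lam bTrain bLasso) :
    empRisk zs bLasso ≤ empRisk zs bTrain := by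
  obtain ⟨h0, -, path, rfl, -, lamHat, -, rfl, hmin⟩ := h
  exact hmin 0 h0

/-- The distance between the validated Lasso and OLS is controlled by the second term of the
bound alone. -/
theorem IsValidatedLasso.norm_sub_le {nt ns p : ℕ} (hns : 1 ≤ ns) {zt : Fin nt → Obs p}
    {zs : Fin ns → Obs p} {Lam : Set ℝ} {bTrain bLasso : Coef p}
    (h : IsValidatedLasso zt zs Lam bTrain bLasso)
    (hρ : 0 < minEigenvalue (gram_isHermitian zs)) :
    ‖bTrain - bLasso‖ ≤ Real.sqrt (4 / (minEigenvalue (gram_isHermitian zs) * ns)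
      * ‖resid zs bTrain ᵥ* design zs‖ * l1norm bTrain) := by
  set ρ := minEigenvalue (gram_isHermitian zs)
  have hn : (0 : ℝ) < ns := by exact_mod_cast hns
  refine Real.le_sqrt_of_sq_le ?_
  have h1 : ρ * ‖bTrain - bLasso‖ ^ 2 ≤ _ :=
    minEigenvalue_mul_norm_sq_le (gram_isHermitian zs) (bTrain - bLasso)
  rw [quadraticForm_gram] at h1
  have h2 := h.empRisk_le
  rw [empRisk, empRisk, mul_le_mul_iff_right₀ (by positivity),
    sum_resid_sq_expand zs bTrain bLasso] at h2
  have h3 := abs_dotProduct_le_norm_mul_l1norm (resid zs bTrain ᵥ* design zs) (bTrain - bLasso)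
  have h4 := neg_abs_le ((resid zs bTrain ᵥ* design zs) ⬝ᵥ (bTrain - bLasso).ofLp)
  -- This factor 2 and the 2 of the cross term in the expansion make the constant 4.
  have h5 : l1norm (bTrain - bLasso) ≤ 2 * l1norm bTrain := by
    linarith [l1norm_sub_le bTrain bLasso, h.l1norm_le]
  have h6 := mul_le_mul_of_nonneg_left h5 (norm_nonneg (resid zs bTrain ᵥ* design zs))
  have h7 : ∑ i, ((zs i).1 ⬝ᵥ (bTrain - bLasso).ofLp) ^ 2
      ≤ 4 * (‖resid zs bTrain ᵥ* design zs‖ * l1norm bTrain) := by linarith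
  have h8 := h1.trans (mul_le_mul_of_nonneg_left h7 (by positivity : 0 ≤ 1 / (ns : ℝ)))
  have h9 : 4 / (ρ * ns) * ‖resid zs bTrain ᵥ* design zs‖ * l1norm bTrain
      = (1 / (ns : ℝ) * (4 * (‖resid zs bTrain ᵥ* design zs‖ * l1norm bTrain))) / ρ := by
    field_simp
  rw [h9, le_div_iff₀ hρ]
  linarith

/-! ### Symmetrization, contraction and uniform deviations -/

theorem integrable_finset_sup' {Z κ : Type*} [MeasurableSpace Z] {F : Measure Z} {T : Finset κ}
    (hT : T.Nonempty) {f : κ → Z → ℝ} (hf : ∀ c ∈ T, Integrable (f c) F) :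
    Integrable (fun z => T.sup' hT fun c => f c z) F := by
  have : Integrable (T.sup' hT f) F :=
    Finset.sup'_induction (p := fun f : Z → ℝ => Integrable f F) hT f
      (fun _ h _ h' => h.sup h') hf
  refine this.congr (Eventually.of_forall fun z => ?_)
  simp [Finset.sup'_apply]

/-- One step of the contraction principle. -/
theorem sup'_add_sup'_contraction {κ : Type*} {T : Finset κ} (hT : T.Nonempty) {φ : ℝ → ℝ} {L : ℝ}
    (hφ : ∀ a b, |φ a - φ b| ≤ L * |a - b|) (A g : κ → ℝ) :
    T.sup' hT (fun c => A c + 2 * φ (g c)) + T.sup' hT (fun c => A c - 2 * φ (g c)) ≤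
      T.sup' hT (fun c => A c + 2 * L * g c) + T.sup' hT (fun c => A c - 2 * L * g c) := by
  obtain ⟨c, hc, h1⟩ := T.exists_mem_eq_sup' hT (fun c => A c + 2 * φ (g c))
  obtain ⟨d, hd, h2⟩ := T.exists_mem_eq_sup' hT (fun c => A c - 2 * φ (g c))
  rw [h1, h2]
  have h3 := T.le_sup' (fun c => A c + 2 * L * g c) hc
  have h4 := T.le_sup' (fun c => A c - 2 * L * g c) hd
  have h5 := T.le_sup' (fun c => A c + 2 * L * g c) hd
  have h6 := T.le_sup' (fun c => A c - 2 * L * g c) hc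
  -- With maximizers c, d of the two left-hand suprema, the sign of g c − g d decides which of them
  -- is the competitor in which supremum on the right.
  have h7 := (le_abs_self _).trans (hφ (g c) (g d))
  rcases abs_cases (g c - g d) with ⟨h, -⟩ | ⟨h, -⟩ <;> rw [h] at h7 <;> linarith

/-- One step of symmetrization and contraction. -/
theorem integral_sup'_centered_le {Z κ : Type*} [MeasurableSpace Z] {F : Measure Z}
    [IsProbabilityMeasure F] {T : Finset κ} (hT : T.Nonempty) {φ : ℝ → ℝ} {L : ℝ}
    (hφ : ∀ a b, |φ a - φ b| ≤ L * |a - b|) (A : κ → ℝ) {g : κ → Z → ℝ}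
    (hg : ∀ c ∈ T, Integrable (g c) F) (hφg : ∀ c ∈ T, Integrable (fun z => φ (g c z)) F) :
    ∫ z, T.sup' hT (fun c => A c + ((∫ z', φ (g c z') ∂F) - φ (g c z))) ∂F ≤
      ∫ z, (T.sup' hT (fun c => A c + 2 * L * g c z)
        + T.sup' hT (fun c => A c - 2 * L * g c z)) / 2 ∂F := by
  have iA : ∀ c, Integrable (fun _ : Z => A c) F := fun c => integrable_const _
  have i1 : Integrable (fun z => T.sup' hT (fun c => A c + 2 * φ (g c z))) F :=
    integrable_finset_sup' hT fun c hc => (iA c).add ((hφg c hc).const_mul 2)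
  have i2 : Integrable (fun z => T.sup' hT (fun c => A c - 2 * φ (g c z))) F :=
    integrable_finset_sup' hT fun c hc => (iA c).sub ((hφg c hc).const_mul 2)
  have i3 : Integrable (fun z => T.sup' hT (fun c => A c + 2 * L * g c z)) F :=
    integrable_finset_sup' hT fun c hc => (iA c).add ((hg c hc).const_mul (2 * L))
  have i4 : Integrable (fun z => T.sup' hT (fun c => A c - 2 * L * g c z)) F :=
    integrable_finset_sup' hT fun c hc => (iA c).sub ((hg c hc).const_mul (2 * L))
  have i5 : Integrable (fun z => T.sup' hT
      (fun c => A c + ((∫ z', φ (g c z') ∂F) - φ (g c z)))) F :=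
    integrable_finset_sup' hT fun c hc => (iA c).add ((integrable_const _).sub (hφg c hc))
  -- The centered term is the average of A + 2∫φ and A − 2φ(z). Splitting the supremum and moving it
  -- inside the inner integral makes z' an independent copy of z, and the two integrals decouple.
  calc _ ≤ ∫ z, ((∫ z', T.sup' hT (fun c => A c + 2 * φ (g c z')) ∂F)
        + T.sup' hT (fun c => A c - 2 * φ (g c z))) / 2 ∂F := by
        refine integral_mono i5 (((integrable_const _).add i2).div_const 2) fun z => ?_
        refine Finset.sup'_le hT _ fun c hc => ?_
        have h1 : ∫ z', (A c + 2 * φ (g c z')) ∂F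
            ≤ ∫ z', T.sup' hT (fun c => A c + 2 * φ (g c z')) ∂F :=
          integral_mono ((iA c).add ((hφg c hc).const_mul 2)) i1 fun z' =>
            T.le_sup' (fun c => A c + 2 * φ (g c z')) hc
        have h2 := T.le_sup' (fun c => A c - 2 * φ (g c z)) hc
        rw [integral_add (iA c) ((hφg c hc).const_mul 2), integral_const_mul] at h1
        simp only [integral_const, probReal_univ, one_smul] at h1
        simp only at h2 ⊢
        linarith
    _ = ∫ z, (T.sup' hT (fun c => A c + 2 * φ (g c z))
        + T.sup' hT (fun c => A c - 2 * φ (g c z))) / 2 ∂F := by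
        rw [integral_div, integral_div, integral_add (integrable_const _) i2, integral_add i1 i2]
        simp
    _ ≤ _ := by
        refine integral_mono ((i1.add i2).div_const 2) ((i3.add i4).div_const 2) fun z => ?_
        have := sup'_add_sup'_contraction hT hφ A (fun c => g c z)
        simp only
        linarith

section UniformDeviation

variable {Z E : Type*} [MeasurableSpace Z] [NormedAddCommGroup E] [InnerProductSpace ℝ E]

theorem integral_fin_succ_pi {n : ℕ} {F : Measure Z} [IsProbabilityMeasure F]
    (h : (Fin (n + 1) → Z) → ℝ) :
    ∫ z, h z ∂(Measure.pi fun _ => F)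
      = ∫ w, h (Fin.cons w.1 w.2) ∂(F.prod (Measure.pi fun _ : Fin n => F)) := by
  have := (measurePreserving_piFinSuccAbove (fun _ : Fin (n + 1) => F) 0).symm
  rw [← this.integral_comp']
  simp [MeasurableEquiv.piFinSuccAbove, Fin.insertNth_zero', Fin.insertNthEquiv]

theorem integrable_inner_of_memLp {F : Measure Z} [IsProbabilityMeasure F] {ψ : Z → E}
    (hψ : MemLp ψ 2 F) (c : E) : Integrable (fun z => inner ℝ c (ψ z)) F :=
  (hψ.integrable (by norm_num)).const_inner c

theorem integrable_comp_inner {F : Measure Z} [IsProbabilityMeasure F] {ψ : Z → E}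
    (hψ : MemLp ψ 2 F) {φ : ℝ → ℝ} {M : ℝ} (hφc : Continuous φ) (hM : ∀ a, |φ a| ≤ M) (c : E) :
    Integrable (fun z => φ (inner ℝ c (ψ z))) F :=
  Integrable.of_bound
    (hφc.comp_aestronglyMeasurable (integrable_inner_of_memLp hψ c).aestronglyMeasurable) M
    (Eventually.of_forall fun _ => hM _)

/-- Bound in the mean for the supremum of a centered empirical process that is indexed by
Lipschitz images of linear functionals, by symmetrization and contraction. -/
theorem integral_sup'_empirical_le {F : Measure Z} [IsProbabilityMeasure F] {ψ : Z → E}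
    (hψ : MemLp ψ 2 F) {φ : ℝ → ℝ} {L M : ℝ} (hφ : ∀ a b, |φ a - φ b| ≤ L * |a - b|)
    (hφc : Continuous φ) (hM : ∀ a, |φ a| ≤ M) {T : Finset E} (hT : T.Nonempty)
    (hball : ∀ c ∈ T, ‖c‖ ≤ 1) {s : ℝ} (hs : 0 < s) (n : ℕ) (v : E) :
    ∫ z, T.sup' hT (fun c => inner ℝ c v
        + ∑ i, ((∫ w, φ (inner ℝ c (ψ w)) ∂F) - φ (inner ℝ c (ψ (z i)))))
        ∂(Measure.pi fun _ : Fin n => F)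
      ≤ (‖v‖ ^ 2 + 4 * L ^ 2 * n * ∫ z, ‖ψ z‖ ^ 2 ∂F) / (2 * s) + s / 2 := by
  -- Each step trades one observation for a shift of v by ±2Lψ(z), and by the parallelogram law the
  -- average of ‖v‖² grows by exactly 4L²‖ψ(z)‖². The bound x ≤ x²/(2s) + s/2 keeps the estimate
  -- affine in ‖v‖², so the induction closes; s is optimized later.
  induction n generalizing v with
  | zero =>
    simp only [Finset.univ_eq_empty, Finset.sum_empty, add_zero, integral_const, probReal_univ,
      one_smul, Nat.cast_zero, mul_zero, zero_mul]
    refine Finset.sup'_le hT _ fun c hc => ?_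
    have h1 : inner ℝ c v ≤ ‖v‖ := (real_inner_le_norm c v).trans
      (by simpa using mul_le_mul_of_nonneg_right (hball c hc) (norm_nonneg v))
    have h2 : ‖v‖ ^ 2 / (2 * s) + s / 2 - ‖v‖ = (‖v‖ - s) ^ 2 / (2 * s) := by
      field_simp; ring
    have h3 : 0 ≤ (‖v‖ - s) ^ 2 / (2 * s) := by positivity
    linarith
  | succ n ih =>
    set m : E → ℝ := fun c => ∫ w, φ (inner ℝ c (ψ w)) ∂F with hm
    set P : Measure (Fin n → Z) := Measure.pi fun _ => F with hP
    replace ih : ∀ v : E, ∫ z, T.sup' hT (fun c => inner ℝ c v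
        + ∑ i, (m c - φ (inner ℝ c (ψ (z i))))) ∂P
      ≤ (‖v‖ ^ 2 + 4 * L ^ 2 * n * ∫ z, ‖ψ z‖ ^ 2 ∂F) / (2 * s) + s / 2 := ih
    have ig := integrable_inner_of_memLp hψ
    have ig' := integrable_comp_inner hψ hφc hM
    have iS : ∀ c, Integrable (fun z : Fin n → Z => ∑ i, (m c - φ (inner ℝ c (ψ (z i))))) P :=
      fun c => integrable_finsetSum _ fun i _ => (integrable_const _).sub
        ((measurePreserving_eval (fun _ : Fin n => F) i).integrable_comp_of_integrable (ig' c))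
    have iu : ∀ κ : ℝ, Integrable (fun w : Z × (Fin n → Z) => T.sup' hT fun c =>
        (inner ℝ c v + ∑ i, (m c - φ (inner ℝ c (ψ (w.2 i))))) + κ * inner ℝ c (ψ w.1))
        (F.prod P) := fun κ => integrable_finset_sup' hT fun c _ =>
      ((integrable_const _).add ((iS c).comp_snd F)).add (((ig c).comp_fst P).const_mul κ)
    have iu' : Integrable (fun w : Z × (Fin n → Z) => T.sup' hT fun c =>
        (inner ℝ c v + ∑ i, (m c - φ (inner ℝ c (ψ (w.2 i))))) - 2 * L * inner ℝ c (ψ w.1))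
        (F.prod P) := by
      refine (iu (-(2 * L))).congr (Eventually.of_forall fun w => ?_)
      simp only [neg_mul, sub_eq_add_neg]
    have iδ : Integrable (fun w : Z × (Fin n → Z) => T.sup' hT fun c =>
        (inner ℝ c v + ∑ i, (m c - φ (inner ℝ c (ψ (w.2 i)))))
          + (m c - φ (inner ℝ c (ψ w.1)))) (F.prod P) :=
      integrable_finset_sup' hT fun c _ =>
        ((integrable_const _).add ((iS c).comp_snd F)).add
          ((integrable_const _).sub ((ig' c).comp_fst P))
    have ih' : ∀ z : Z, (∫ y, T.sup' hT (fun c =>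
          (inner ℝ c v + ∑ i, (m c - φ (inner ℝ c (ψ (y i))))) + 2 * L * inner ℝ c (ψ z)) ∂P
        + ∫ y, T.sup' hT (fun c =>
          (inner ℝ c v + ∑ i, (m c - φ (inner ℝ c (ψ (y i))))) - 2 * L * inner ℝ c (ψ z)) ∂P) / 2
        ≤ (‖v‖ ^ 2 + 4 * L ^ 2 * ‖ψ z‖ ^ 2 + 4 * L ^ 2 * n * ∫ z, ‖ψ z‖ ^ 2 ∂F) / (2 * s)
          + s / 2 := by
      intro z
      have h1 := ih (v + (2 * L) • ψ z)
      have h2 := ih (v - (2 * L) • ψ z)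
      simp only [inner_add_right, inner_sub_right, inner_smul_right] at h1 h2
      have h3 := parallelogram_law_with_norm ℝ v ((2 * L) • ψ z)
      rw [norm_smul, Real.norm_eq_abs] at h3
      have h4 : (|2 * L| * ‖ψ z‖) ^ 2 = 4 * L ^ 2 * ‖ψ z‖ ^ 2 := by
        rw [mul_pow, sq_abs]; ring
      rw [h4] at h3
      have e1 : ∀ y : Fin n → Z, (fun c : E => inner ℝ c v + 2 * L * inner ℝ c (ψ z)
          + ∑ i, (m c - φ (inner ℝ c (ψ (y i))))) = fun c => (inner ℝ c v
          + ∑ i, (m c - φ (inner ℝ c (ψ (y i))))) + 2 * L * inner ℝ c (ψ z) := by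
        intro y; ext c; ring
      have e2 : ∀ y : Fin n → Z, (fun c : E => inner ℝ c v - 2 * L * inner ℝ c (ψ z)
          + ∑ i, (m c - φ (inner ℝ c (ψ (y i))))) = fun c => (inner ℝ c v
          + ∑ i, (m c - φ (inner ℝ c (ψ (y i))))) - 2 * L * inner ℝ c (ψ z) := by
        intro y; ext c; ring
      simp only [e1] at h1
      simp only [e2] at h2
      calc _ ≤ ((‖v + (2 * L) • ψ z‖ ^ 2 + 4 * L ^ 2 * n * ∫ z, ‖ψ z‖ ^ 2 ∂F) / (2 * s) + s / 2
            + ((‖v - (2 * L) • ψ z‖ ^ 2 + 4 * L ^ 2 * n * ∫ z, ‖ψ z‖ ^ 2 ∂F) / (2 * s) + s / 2))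
              / 2 := by linarith
        _ = ((‖v + (2 * L) • ψ z‖ ^ 2 + ‖v - (2 * L) • ψ z‖ ^ 2) / 2
              + 4 * L ^ 2 * n * ∫ z, ‖ψ z‖ ^ 2 ∂F) / (2 * s) + s / 2 := by ring
        _ = _ := by rw [h3]; ring
    have hψ2 : Integrable (fun z => ‖ψ z‖ ^ 2) F := hψ.integrable_norm_pow (by norm_num)
    calc _ = ∫ w, T.sup' hT (fun c =>
        (inner ℝ c v + ∑ i, (m c - φ (inner ℝ c (ψ (w.2 i)))))
          + (m c - φ (inner ℝ c (ψ w.1)))) ∂(F.prod P) := by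
          rw [integral_fin_succ_pi]
          refine integral_congr_ae (Eventually.of_forall fun w => ?_)
          simp only [Fin.sum_univ_succ, Fin.cons_zero, Fin.cons_succ]
          refine congrArg _ (funext fun c => ?_)
          ring
      _ = ∫ y, ∫ z, T.sup' hT (fun c =>
        (inner ℝ c v + ∑ i, (m c - φ (inner ℝ c (ψ (y i)))))
          + (m c - φ (inner ℝ c (ψ z)))) ∂F ∂P := integral_prod_symm _ iδ
      _ ≤ ∫ y, ∫ z, (T.sup' hT (fun c =>
          (inner ℝ c v + ∑ i, (m c - φ (inner ℝ c (ψ (y i))))) + 2 * L * inner ℝ c (ψ z))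
        + T.sup' hT (fun c =>
          (inner ℝ c v + ∑ i, (m c - φ (inner ℝ c (ψ (y i)))))
            - 2 * L * inner ℝ c (ψ z))) / 2 ∂F ∂P :=
          integral_mono iδ.integral_prod_right
            (((iu (2 * L)).add iu').div_const 2).integral_prod_right fun y =>
            integral_sup'_centered_le hT hφ _ (fun c _ => ig c) (fun c _ => ig' c)
      _ = ∫ z, ∫ y, (T.sup' hT (fun c =>
          (inner ℝ c v + ∑ i, (m c - φ (inner ℝ c (ψ (y i))))) + 2 * L * inner ℝ c (ψ z))
        + T.sup' hT (fun c =>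
          (inner ℝ c v + ∑ i, (m c - φ (inner ℝ c (ψ (y i)))))
            - 2 * L * inner ℝ c (ψ z))) / 2 ∂P ∂F :=
          (integral_integral_swap (((iu (2 * L)).add iu').div_const 2)).symm
      _ ≤ ∫ z, ((‖v‖ ^ 2 + 4 * L ^ 2 * ‖ψ z‖ ^ 2 + 4 * L ^ 2 * n * ∫ z, ‖ψ z‖ ^ 2 ∂F) / (2 * s)
          + s / 2) ∂F := by
          refine integral_mono_ae (((iu (2 * L)).add iu').div_const 2).integral_prod_left
            ?_ ?_
          · exact ((((integrable_const _).add (hψ2.const_mul _)).add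
              (integrable_const _)).div_const _).add (integrable_const _)
          · filter_upwards [(iu (2 * L)).prod_right_ae, iu'.prod_right_ae] with z h1 h2
            refine le_trans (le_of_eq ?_) (ih' z)
            rw [integral_div]
            congr 1
            exact integral_add h1 h2
      _ = _ := by
          rw [integral_add, integral_div, integral_add, integral_add, integral_const_mul]
          · simp only [integral_const, probReal_univ, one_smul, Nat.cast_succ]
            ring
          · exact integrable_const _
          · exact hψ2.const_mul _
          · exact (integrable_const _).add (hψ2.const_mul _)
          · exact integrable_const _
          · exact (((integrable_const _).add (hψ2.const_mul _)).add
              (integrable_const _)).div_const _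
          · exact integrable_const _

/-- Tail bound for the supremum of a centered empirical process. -/
theorem measure_exists_empirical_ge_le {F : Measure Z} [IsProbabilityMeasure F] {ψ : Z → E}
    (hψ : MemLp ψ 2 F) {φ : ℝ → ℝ} {L M : ℝ} (hφ : ∀ a b, |φ a - φ b| ≤ L * |a - b|)
    (hφc : Continuous φ) (hM : ∀ a, |φ a| ≤ M) (T : Finset E)
    (hball : ∀ c ∈ T, ‖c‖ ≤ 1) {d t : ℝ} (hL : 0 < L) (hd : 0 < d)
    (hD : ∫ z, ‖ψ z‖ ^ 2 ∂F ≤ d) (ht : 0 < t) {n : ℕ} (hn : 1 ≤ n) :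
    (Measure.pi fun _ : Fin n => F)
        {z | ∃ c ∈ T, t ≤ (∫ w, φ (inner ℝ c (ψ w)) ∂F)
          - (1 / (n : ℝ)) * ∑ i, φ (inner ℝ c (ψ (z i)))}
      ≤ ENNReal.ofReal (2 * L * Real.sqrt (d / n) / t) := by
  classical
  have hn' : (0 : ℝ) < n := by exact_mod_cast hn
  set P := Measure.pi fun _ : Fin n => F
  -- The process vanishes at c = 0, so including 0 makes the supremum nonnegative, as Markov's
  -- inequality requires.
  set T' := insert (0 : E) T
  have hT' : T'.Nonempty := Finset.insert_nonempty _ _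
  have hball' : ∀ c ∈ T', ‖c‖ ≤ 1 := by
    intro c hc
    rcases Finset.mem_insert.mp hc with rfl | hc
    · simp
    · exact hball c hc
  -- The optimal s: both halves of the mean bound become s/2.
  set s : ℝ := 2 * L * Real.sqrt (n * d) with hs
  have hs0 : 0 < s := by positivity
  have hs2 : s ^ 2 = 4 * L ^ 2 * n * d := by
    rw [hs, mul_pow, Real.sq_sqrt (by positivity)]; ring
  set f : (Fin n → Z) → ℝ := fun z => T'.sup' hT' (fun c => inner ℝ c (0 : E)
        + ∑ i, ((∫ w, φ (inner ℝ c (ψ w)) ∂F) - φ (inner ℝ c (ψ (z i))))) with hf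
  have h1 : ∫ z, f z ∂P ≤ s := by
    refine (integral_sup'_empirical_le hψ hφ hφc hM hT' hball' hs0 n 0).trans ?_
    have : 4 * L ^ 2 * n * ∫ z, ‖ψ z‖ ^ 2 ∂F ≤ s ^ 2 := by
      rw [hs2]; exact mul_le_mul_of_nonneg_left hD (by positivity)
    have h2 : (‖(0 : E)‖ ^ 2 + 4 * L ^ 2 * n * ∫ z, ‖ψ z‖ ^ 2 ∂F) / (2 * s)
        ≤ s ^ 2 / (2 * s) := by
      gcongr
      simpa using this
    have h3 : s ^ 2 / (2 * s) = s / 2 := by field_simp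
    linarith
  have hf0 : ∀ z, 0 ≤ f z := fun z => by
    refine le_trans (le_of_eq ?_) (T'.le_sup' _ (Finset.mem_insert_self 0 T))
    simp
  have ig' := integrable_comp_inner hψ hφc hM
  have hfi : Integrable f P := integrable_finset_sup' hT' fun c _ =>
    (integrable_const _).add (integrable_finsetSum _ fun i _ => (integrable_const _).sub
        ((measurePreserving_eval (fun _ : Fin n => F) i).integrable_comp_of_integrable (ig' c)))
  have h2 := mul_meas_ge_le_integral_of_nonneg (Eventually.of_forall hf0) hfi (n * t)
  have h3 : P.real {z | n * t ≤ f z} ≤ 2 * L * Real.sqrt (d / n) / t := by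
    rw [le_div_iff₀ ht]
    have : Real.sqrt (n * d) = n * Real.sqrt (d / n) := by
      rw [show (n : ℝ) * d = n ^ 2 * (d / n) by field_simp, Real.sqrt_mul (by positivity),
        Real.sqrt_sq hn'.le]
    rw [hs, this] at h1
    have := h2.trans h1
    refine le_of_mul_le_mul_left ?_ hn'
    linarith
  calc _ ≤ P {z | n * t ≤ f z} := by
        refine measure_mono ?_
        rintro z ⟨c, hc, h⟩
        refine le_trans ?_ (T'.le_sup' (fun c => inner ℝ c (0 : E)
          + ∑ i, ((∫ w, φ (inner ℝ c (ψ w)) ∂F) - φ (inner ℝ c (ψ (z i)))))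
          (Finset.mem_insert_of_mem hc))
        have : (n : ℝ) * ((∫ w, φ (inner ℝ c (ψ w)) ∂F)
          - (1 / (n : ℝ)) * ∑ i, φ (inner ℝ c (ψ (z i)))) = inner ℝ c (0 : E)
        + ∑ i, ((∫ w, φ (inner ℝ c (ψ w)) ∂F) - φ (inner ℝ c (ψ (z i)))) := by
          simp only [inner_zero_right, Finset.sum_sub_distrib, Finset.sum_const, Finset.card_univ,
            Fintype.card_fin, nsmul_eq_mul]
          field_simp
          ring
        rw [← this]
        exact mul_le_mul_of_nonneg_left h hn'.le
    _ = ENNReal.ofReal (P.real {z | n * t ≤ f z}) := (ofReal_measureReal).symm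
    _ ≤ _ := ENNReal.ofReal_le_ofReal h3

end UniformDeviation

/-! ### Population risk and whitening -/

section Model

variable {p : ℕ} {F : Measure (Obs p)} {β : Coef p}

theorem IsLinearModel.memLp_dotProduct (h : IsLinearModel F β) (v : Fin p → ℝ) :
    MemLp (fun z : Obs p => z.1 ⬝ᵥ v) 2 F := by
  have : MemLp (fun z : Obs p => ∑ j, z.1 j * v j) 2 F :=
    memLp_finsetSum _ fun j _ => (h.memLp_regressor j).mul_const (v j)
  exact this

theorem IsLinearModel.memLp_disturbance (h : IsLinearModel F β) (b : Coef p) :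
    MemLp (disturbance b) 2 F :=
  h.memLp_response.sub (h.memLp_dotProduct _)

theorem IsLinearModel.integrable_loss (h : IsLinearModel F β) (b : Coef p) :
    Integrable (loss b) F :=
  (h.memLp_disturbance b).integrable_sq

theorem loss_nonneg (b : Coef p) (z : Obs p) : 0 ≤ loss b z := sq_nonneg _

theorem risk_nonneg (F : Measure (Obs p)) (b : Coef p) : 0 ≤ risk F b :=
  integral_nonneg fun z => loss_nonneg b z

/-- The quadratic form of the population second moment matrix. -/
theorem IsLinearModel.integral_dotProduct_sq (h : IsLinearModel F β) (v : Fin p → ℝ) :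
    ∫ z, (z.1 ⬝ᵥ v) ^ 2 ∂F = v ⬝ᵥ (popGram F *ᵥ v) := by
  have h1 : ∀ z : Obs p, (z.1 ⬝ᵥ v) ^ 2 = ∑ i, ∑ j, v i * (z.1 i * z.1 j * v j) := by
    intro z
    simp only [sq, dotProduct, Finset.sum_mul_sum]
    exact Finset.sum_congr rfl fun i _ => Finset.sum_congr rfl fun j _ => by ring
  have hi : ∀ i j, Integrable (fun z : Obs p => v i * (z.1 i * z.1 j * v j)) F := fun i j =>
    (((h.memLp_regressor i).integrable_mul (h.memLp_regressor j)).mul_const _).const_mul _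
  simp only [h1]
  rw [integral_finsetSum _ fun i _ => integrable_finsetSum _ fun j _ => hi i j]
  simp only [dotProduct, mulVec, popGram, Matrix.of_apply, Finset.mul_sum]
  refine Finset.sum_congr rfl fun i _ => ?_
  rw [integral_finsetSum _ fun j _ => hi i j]
  refine Finset.sum_congr rfl fun j _ => ?_
  rw [integral_const_mul, integral_mul_const]

/-- Exogeneity kills the cross term in the expansion around β. -/
theorem IsLinearModel.risk_eq (h : IsLinearModel F β) (b : Coef p) :
    risk F b = risk F β + (b - β).ofLp ⬝ᵥ (popGram F *ᵥ (b - β).ofLp) := by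
  rw [← h.integral_dotProduct_sq]
  have h1 : ∀ z : Obs p, loss b z = loss β z + (z.1 ⬝ᵥ (b - β).ofLp) ^ 2
      - ∑ j, disturbance β z * z.1 j * (2 * (b - β) j) := by
    intro z
    have h2 : ∑ j, disturbance β z * z.1 j * (2 * (b - β) j)
        = 2 * disturbance β z * (z.1 ⬝ᵥ (b - β).ofLp) := by
      simp only [dotProduct, Finset.mul_sum]
      exact Finset.sum_congr rfl fun i _ => by ring
    rw [h2]
    simp only [loss, disturbance, WithLp.ofLp_sub, dotProduct_sub]
    ring
  have hi : ∀ j, Integrable (fun z => disturbance β z * z.1 j * (2 * (b - β) j)) F := fun j =>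
    ((h.memLp_disturbance β).integrable_mul (h.memLp_regressor j)).mul_const _
  have hq : Integrable (fun z : Obs p => (z.1 ⬝ᵥ (b - β).ofLp) ^ 2) F :=
    (h.memLp_dotProduct _).integrable_sq
  rw [risk, risk]
  simp only [h1]
  have hlq : Integrable (fun z => loss β z + (z.1 ⬝ᵥ (b - β).ofLp) ^ 2) F :=
    (h.integrable_loss β).add hq
  rw [integral_sub hlq (integrable_finsetSum _ fun j _ => hi j),
    integral_add (h.integrable_loss β) hq, integral_finsetSum _ fun j _ => hi j]
  simp only [integral_mul_const, h.exogenous, zero_mul, Finset.sum_const_zero, sub_zero]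

theorem continuous_quadraticForm (A : Matrix (Fin p) (Fin p) ℝ) :
    Continuous fun d : Coef p => d.ofLp ⬝ᵥ (A *ᵥ d.ofLp) := by
  fun_prop

theorem IsLinearModel.continuous_risk (h : IsLinearModel F β) : Continuous (risk F) := by
  rw [show risk F = fun b => _ from funext h.risk_eq]
  exact continuous_const.add
    ((continuous_quadraticForm (popGram F)).comp (continuous_id.sub continuous_const))

theorem continuous_empRisk {n : ℕ} (z : Fin n → Obs p) : Continuous (empRisk z) := by
  unfold empRisk
  simp only [resid_apply]
  fun_prop

theorem IsLinearModel.quadraticForm_popGram_nonneg (h : IsLinearModel F β) (v : Fin p → ℝ) :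
    0 ≤ v ⬝ᵥ (popGram F *ᵥ v) := by
  rw [← h.integral_dotProduct_sq]
  exact integral_nonneg fun z => sq_nonneg _

theorem IsLinearModel.risk_le (h : IsLinearModel F β) (b : Coef p) : risk F β ≤ risk F b := by
  rw [h.risk_eq b]
  linarith [h.quadraticForm_popGram_nonneg (b - β).ofLp]

theorem IsLinearModel.risk_le_response (h : IsLinearModel F β) :
    risk F β ≤ ∫ z, z.2 ^ 2 ∂F := by
  refine (h.risk_le 0).trans (le_of_eq ?_)
  simp [risk, loss]

/-- In a linear model with a nonsingular second moment matrix, the residuals of all linear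
predictors, scaled by `√(risk + 1)`, are linear functionals in the unit ball of a common vector of
features with second moments at most `1`. -/
theorem IsLinearModel.exists_whitening [IsProbabilityMeasure F] (h : IsLinearModel F β)
    (hpos : 0 < minEigenvalue (popGram_isHermitian F)) :
    ∃ ψ : Obs p → EuclideanSpace ℝ (Option (Fin p)), MemLp ψ 2 F ∧
      ∫ z, ‖ψ z‖ ^ 2 ∂F ≤ p + 1 ∧
      ∀ b : Coef p, ∃ c : EuclideanSpace ℝ (Option (Fin p)), ‖c‖ ≤ 1 ∧
        ∀ z, inner ℝ c (ψ z) = disturbance b z / Real.sqrt (risk F b + 1) := by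
  set hA := popGram_isHermitian F
  set e := hA.eigenvectorBasis
  set l := hA.eigenvalues
  have hl : ∀ j, 0 < l j := fun j => hpos.trans_le (minEigenvalue_le hA j)
  -- The added 1 keeps the scale positive even when the risk is zero.
  set s := Real.sqrt (risk F β + 1)
  have hs : 0 < s := Real.sqrt_pos.mpr (by linarith [risk_nonneg F β])
  have hs2 : s ^ 2 = risk F β + 1 := Real.sq_sqrt (by linarith [risk_nonneg F β])
  -- One coordinate carries the disturbance; the others carry the regressors in the eigenbasis,
  -- scaled to second moment 1.
  set ψ : Obs p → EuclideanSpace ℝ (Option (Fin p)) := fun z => WithLp.toLp 2 fun o =>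
    o.elim (disturbance β z / s) fun j => (z.1 ⬝ᵥ (e j).ofLp) / Real.sqrt (l j) with hψ
  have hcoord : ∀ o, MemLp (fun z => ψ z o) 2 F := by
    intro o
    cases o with
    | none => exact (h.memLp_disturbance β).mul_const s⁻¹
    | some j => exact (h.memLp_dotProduct _).mul_const _
  have hnorm : ∀ z, ‖ψ z‖ ^ 2 = (disturbance β z) ^ 2 / s ^ 2
      + ∑ j, (z.1 ⬝ᵥ (e j).ofLp) ^ 2 / l j := by
    intro z
    rw [EuclideanSpace.norm_sq_eq, Fintype.sum_option]
    simp only [hψ, Option.elim, Real.norm_eq_abs, sq_abs, div_pow, Real.sq_sqrt (hl _).le]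
  refine ⟨ψ, ?_, ?_, ?_⟩
  · have hm : AEStronglyMeasurable ψ F := by
      refine (PiLp.continuous_toLp 2 _).comp_aestronglyMeasurable
        (aemeasurable_pi_lambda _ fun o => ?_).aestronglyMeasurable
      exact (hcoord o).aestronglyMeasurable.aemeasurable
    rw [memLp_two_iff_integrable_sq_norm hm]
    simp only [EuclideanSpace.norm_sq_eq, Real.norm_eq_abs, sq_abs]
    exact integrable_finsetSum _ fun o _ => (hcoord o).integrable_sq
  · simp only [hnorm]
    have hu : Integrable (fun z => disturbance β z ^ 2 / s ^ 2) F :=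
      (h.integrable_loss β).div_const _
    rw [integral_add hu
      (integrable_finsetSum _ fun j _ => (h.memLp_dotProduct _).integrable_sq.div_const _),
      integral_finsetSum _ fun j _ => (h.memLp_dotProduct _).integrable_sq.div_const _,
      integral_div, add_comm]
    refine add_le_add ?_ ?_
    · have : ∀ j, ∫ z, (z.1 ⬝ᵥ (e j).ofLp) ^ 2 / l j ∂F = 1 := by
        intro j
        rw [integral_div, h.integral_dotProduct_sq, quadraticForm_eq_sum_eigenvalues hA,
          Finset.sum_eq_single j]
        · have : inner ℝ (e j) (e j) = (1 : ℝ) := by simp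
          rw [this, one_pow, mul_one]
          exact div_self (hl j).ne'
        · intro i _ hij
          rw [show inner ℝ (hA.eigenvectorBasis i) (e j) = (0 : ℝ) from
            e.orthonormal.2 hij]
          simp
        · simp
      simp [this]
    · rw [hs2]
      change risk F β / (risk F β + 1) ≤ 1
      rw [div_le_one (by linarith [risk_nonneg F β])]
      linarith
  · intro b
    set r := Real.sqrt (risk F b + 1)
    have hr : 0 < r := Real.sqrt_pos.mpr (by linarith [risk_nonneg F b])
    have hr2 : r ^ 2 = risk F b + 1 := Real.sq_sqrt (by linarith [risk_nonneg F b])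
    -- The squared coefficients sum to (risk β + 1 + excess risk of b)/(risk b + 1) = 1.
    refine ⟨WithLp.toLp 2 fun o => o.elim (s / r)
      fun j => -(Real.sqrt (l j) * inner ℝ (e j) (b - β)) / r, ?_, ?_⟩
    · have : ∑ j, (Real.sqrt (l j) * inner ℝ (e j) (b - β)) ^ 2 / r ^ 2
          = ((b - β).ofLp ⬝ᵥ (popGram F *ᵥ (b - β).ofLp)) / r ^ 2 := by
        rw [quadraticForm_eq_sum_eigenvalues hA, Finset.sum_div]
        refine Finset.sum_congr rfl fun j _ => ?_
        rw [mul_pow, Real.sq_sqrt (hl j).le]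
      refine (sq_le_one_iff₀ (norm_nonneg _)).mp (le_of_eq ?_)
      rw [EuclideanSpace.norm_sq_eq, Fintype.sum_option]
      simp only [Option.elim, Real.norm_eq_abs, sq_abs, div_pow, neg_sq]
      rw [this, hs2, hr2, ← add_div, div_eq_one_iff_eq (by linarith [risk_nonneg F b]),
        h.risk_eq b]
      ring
    · intro z
      have h1 : z.1 ⬝ᵥ (b - β).ofLp = ∑ j, (z.1 ⬝ᵥ (e j).ofLp) * inner ℝ (e j) (b - β) := by
        have := e.sum_inner_mul_inner (WithLp.toLp 2 z.1) (b - β)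
        have h2 : ∀ v : Coef p, inner ℝ (WithLp.toLp 2 z.1) v = z.1 ⬝ᵥ v.ofLp := fun v => by
          simp [PiLp.inner_apply, dotProduct, mul_comm]
        simp only [h2] at this
        exact this.symm
      have h3 : disturbance b z = disturbance β z - z.1 ⬝ᵥ (b - β).ofLp := by
        simp only [disturbance, WithLp.ofLp_sub, dotProduct_sub]
        ring
      rw [PiLp.inner_apply, Fintype.sum_option, h3, h1, sub_div, sub_eq_add_neg (disturbance β z / r),
        Finset.sum_div, ← Finset.sum_neg_distrib]
      congr 1
      · simp only [hψ, Option.elim, RCLike.inner_apply, conj_trivial]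
        field_simp
      · refine Finset.sum_congr rfl fun j _ => ?_
        have := (Real.sqrt_pos.mpr (hl j)).ne'
        simp only [hψ, Option.elim, RCLike.inner_apply, conj_trivial]
        field_simp

end Model

/-! ### Truncation and relative deviations of the empirical risk -/

/-- The squared loss truncated at the level `K ^ 2`. -/
noncomputable def truncSq (K a : ℝ) : ℝ := min (a ^ 2) (K ^ 2)

theorem truncSq_nonneg (K a : ℝ) : 0 ≤ truncSq K a := le_min (sq_nonneg _) (sq_nonneg _)

/-- Truncation commutes with squaring: the function is min(|a|, K)², and squaring is 2K-Lipschitz on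
[0, K]. -/
theorem truncSq_lipschitz {K : ℝ} (hK : 0 < K) (a b : ℝ) :
    |truncSq K a - truncSq K b| ≤ 2 * K * |a - b| := by
  have h : ∀ a : ℝ, truncSq K a = (min |a| K) ^ 2 := by
    intro a
    rw [truncSq, ← sq_abs a]
    rcases le_total |a| K with h | h
    · rw [min_eq_left h, min_eq_left (pow_le_pow_left₀ (abs_nonneg a) h 2)]
    · rw [min_eq_right h, min_eq_right (pow_le_pow_left₀ hK.le h 2)]
  have h0 : ∀ a : ℝ, 0 ≤ min |a| K := fun a => le_min (abs_nonneg a) hK.le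
  rw [h, h, sq_sub_sq, abs_mul]
  refine mul_le_mul ?_ ?_ (abs_nonneg _) (by positivity)
  · rw [abs_of_nonneg (add_nonneg (h0 a) (h0 b))]
    linarith [min_le_right |a| K, min_le_right |b| K]
  · calc |min |a| K - min |b| K| ≤ max |(|a| - |b|)| |K - K| := abs_min_sub_min_le_max _ _ _ _
      _ = |(|a| - |b|)| := by simp
      _ ≤ |a - b| := abs_abs_sub_abs_le _ _

theorem continuous_truncSq (K : ℝ) : Continuous (truncSq K) := by
  unfold truncSq
  fun_prop

theorem abs_truncSq_le (K a : ℝ) : |truncSq K a| ≤ K ^ 2 := by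
  rw [abs_of_nonneg (truncSq_nonneg K a)]
  exact min_le_right _ _

/-- Above the level M, h = h^(1−q) h^q and the exponent 1 − q is negative. This turns a q-th moment
into a small excess. -/
theorem sub_min_le_rpow {q h M : ℝ} (hq : 1 < q) (hh : 0 ≤ h) (hM : 0 < M) :
    h - min h M ≤ M ^ (1 - q) * h ^ q := by
  rcases le_total h M with hle | hle
  · rw [min_eq_left hle, sub_self]
    positivity
  · rw [min_eq_right hle]
    have hpos : 0 < h := hM.trans_le hle
    have h1 : h ^ (1 - q) ≤ M ^ (1 - q) :=
      Real.rpow_le_rpow_of_nonpos hM hle (by linarith)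
    have h2 : h = h ^ (1 - q) * h ^ q := by
      rw [← Real.rpow_add hpos]; simp
    have h3 := mul_le_mul_of_nonneg_right h1 (Real.rpow_nonneg hh q)
    linarith

section Truncation

variable {p : ℕ} {F : Measure (Obs p)} {β : Coef p}

/-- The scaled loss has a uniformly small mean above a high truncation level. -/
theorem IsLinearModel.integral_excess_le [IsProbabilityMeasure F] (h : IsLinearModel F β) {q τ : ℝ}
    (hq : 1 < q) (hτ : 0 < τ) (htail : TailRatioLE q τ F) {K : ℝ} (hK : 0 < K) (b : Coef p) :
    ∫ z, (loss b z / (risk F b + 1)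
        - truncSq K (disturbance b z / Real.sqrt (risk F b + 1))) ∂F
      ≤ (K ^ 2) ^ (1 - q) * τ ^ q := by
  have hR := risk_nonneg F b
  have hR1 : 0 < risk F b + 1 := by linarith
  have hq0 : 0 < q := by linarith
  have htr : ∀ z, truncSq K (disturbance b z / Real.sqrt (risk F b + 1))
      = min (loss b z / (risk F b + 1)) (K ^ 2) := by
    intro z
    rw [truncSq, div_pow, Real.sq_sqrt hR1.le]
    rfl
  simp only [htr]
  have hb := htail b
  have e1 : eLpNorm (loss b) 1 F = ENNReal.ofReal (risk F b) := by
    rw [eLpNorm_one_eq_lintegral_enorm, risk,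
      ofReal_integral_eq_lintegral_ofReal (h.integrable_loss b)
        (Eventually.of_forall fun z => loss_nonneg b z)]
    refine lintegral_congr fun z => ?_
    exact Real.enorm_of_nonneg (loss_nonneg b z)
  -- The tail condition becomes ∫ loss^q ≤ (τ risk)^q; division by (risk + 1)^q later removes all
  -- dependence on b.
  rw [e1, ← ENNReal.ofReal_mul hτ.le,
    eLpNorm_eq_lintegral_rpow_enorm_toReal (by simpa using hq0) ENNReal.ofReal_ne_top,
    ENNReal.toReal_ofReal hq0.le, one_div, ENNReal.rpow_inv_le_iff hq0,
    ENNReal.ofReal_rpow_of_nonneg (by positivity) hq0.le] at hb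
  have e2 : ∫⁻ z, ‖loss b z‖ₑ ^ q ∂F = ∫⁻ z, ENNReal.ofReal (loss b z ^ q) ∂F := by
    refine lintegral_congr fun z => ?_
    rw [Real.enorm_of_nonneg (loss_nonneg b z),
      ENNReal.ofReal_rpow_of_nonneg (loss_nonneg b z) hq0.le]
  rw [e2] at hb
  set a : ℝ := (K ^ 2) ^ (1 - q) / (risk F b + 1) ^ q with ha
  have ha0 : 0 ≤ a := by positivity
  have hpt : ∀ z, loss b z / (risk F b + 1) - min (loss b z / (risk F b + 1)) (K ^ 2)
      ≤ a * loss b z ^ q := by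
    intro z
    refine (sub_min_le_rpow hq (div_nonneg (loss_nonneg b z) hR1.le) (by positivity)).trans
      (le_of_eq ?_)
    rw [Real.div_rpow (loss_nonneg b z) hR1.le, ha]
    ring
  have hnn : ∀ z, 0 ≤ loss b z / (risk F b + 1) - min (loss b z / (risk F b + 1)) (K ^ 2) :=
    fun z => sub_nonneg.mpr (min_le_left _ _)
  have hint : Integrable (fun z => loss b z / (risk F b + 1)
      - min (loss b z / (risk F b + 1)) (K ^ 2)) F := by
    have h1 := (h.integrable_loss b).div_const (risk F b + 1)
    exact h1.sub (h1.inf (integrable_const _))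
  rw [integral_eq_lintegral_of_nonneg_ae (Eventually.of_forall hnn) hint.aestronglyMeasurable]
  refine ENNReal.toReal_le_of_le_ofReal (by positivity) ?_
  calc _ ≤ ∫⁻ z, ENNReal.ofReal a * ENNReal.ofReal (loss b z ^ q) ∂F := by
        refine lintegral_mono fun z => ?_
        rw [← ENNReal.ofReal_mul ha0]
        exact ENNReal.ofReal_le_ofReal (hpt z)
    _ = ENNReal.ofReal a * ∫⁻ z, ENNReal.ofReal (loss b z ^ q) ∂F :=
        lintegral_const_mul' _ _ ENNReal.ofReal_ne_top
    _ ≤ ENNReal.ofReal a * ENNReal.ofReal ((τ * risk F b) ^ q) := by gcongr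
    _ = ENNReal.ofReal (a * (τ * risk F b) ^ q) := (ENNReal.ofReal_mul ha0).symm
    _ ≤ _ := by
        refine ENNReal.ofReal_le_ofReal ?_
        rw [Real.mul_rpow hτ.le hR, ha]
        have h1 : risk F b ^ q ≤ (risk F b + 1) ^ q :=
          Real.rpow_le_rpow hR (by linarith) hq0.le
        have h2 : 0 < (risk F b + 1) ^ q := Real.rpow_pos_of_pos hR1 q
        have h3 : 0 ≤ (K ^ 2) ^ (1 - q) * τ ^ q := by positivity
        calc _ = (K ^ 2) ^ (1 - q) * τ ^ q * (risk F b ^ q / (risk F b + 1) ^ q) := by ring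
          _ ≤ (K ^ 2) ^ (1 - q) * τ ^ q * 1 := by
            refine mul_le_mul_of_nonneg_left ?_ h3
            rwa [div_le_one h2]
          _ = _ := mul_one _

theorem IsLinearModel.integrable_truncSq [IsProbabilityMeasure F] (h : IsLinearModel F β) (K : ℝ)
    (b : Coef p) (r : ℝ) : Integrable (fun z => truncSq K (disturbance b z / r)) F :=
  Integrable.of_bound ((continuous_truncSq K).comp_aestronglyMeasurable
    ((h.memLp_disturbance b).aestronglyMeasurable.mul_const r⁻¹)) (K ^ 2)
    (Eventually.of_forall fun _ => abs_truncSq_le _ _)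

/-- Uniform relative lower deviations of the empirical risk, over finitely many predictors. -/
theorem IsLinearModel.measure_exists_mem_empRisk_lt_le [IsProbabilityMeasure F]
    (h : IsLinearModel F β)
    (hpos : 0 < minEigenvalue (popGram_isHermitian F)) {q τ : ℝ}
    (hq : 1 < q) (hτ : 0 < τ) (htail : TailRatioLE q τ F) {K t : ℝ} (hK : 0 < K) (ht : 0 < t)
    {n : ℕ} (hn : 1 ≤ n) (T : Finset (Coef p)) :
    (Measure.pi fun _ : Fin n => F)
        {z | ∃ b ∈ T, empRisk z b
          < risk F b - ((K ^ 2) ^ (1 - q) * τ ^ q + t) * (risk F b + 1)}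
      ≤ ENNReal.ofReal (4 * K * Real.sqrt ((p + 1) / n) / t) := by
  classical
  obtain ⟨ψ, hψ, hD, hc⟩ := h.exists_whitening hpos
  choose c hc1 hc2 using hc
  -- Truncation lowers the empirical side for free and costs the mean only the excess. The constant
  -- 4K is 2L with L = 2K.
  have key := measure_exists_empirical_ge_le hψ (truncSq_lipschitz hK) (continuous_truncSq K)
    (abs_truncSq_le K) (T.image c) (by
      intro c' hc'
      obtain ⟨b, -, rfl⟩ := Finset.mem_image.mp hc'
      exact hc1 b) (by positivity) (by positivity : (0 : ℝ) < p + 1) hD ht hn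
  refine (measure_mono ?_).trans (key.trans (le_of_eq (by ring_nf)))
  rintro z ⟨b, hb, hlt⟩
  refine ⟨c b, Finset.mem_image_of_mem c hb, ?_⟩
  simp only [hc2]
  have hR := risk_nonneg F b
  have hR1 : 0 < risk F b + 1 := by linarith
  have h1 := h.integral_excess_le hq hτ htail hK b
  rw [integral_sub ((h.integrable_loss b).div_const _) (h.integrable_truncSq K b _),
    integral_div] at h1
  have h2 : (1 / (n : ℝ)) * ∑ i, truncSq K (disturbance b (z i) / Real.sqrt (risk F b + 1))
      ≤ empRisk z b / (risk F b + 1) := by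
    rw [empRisk_eq_sum_loss, mul_div_assoc, Finset.sum_div]
    refine mul_le_mul_of_nonneg_left (Finset.sum_le_sum fun i _ => ?_) (by positivity)
    rw [truncSq, div_pow, Real.sq_sqrt hR1.le]
    exact min_le_left _ _
  have h3 : empRisk z b / (risk F b + 1)
      < risk F b / (risk F b + 1) - ((K ^ 2) ^ (1 - q) * τ ^ q + t) := by
    rw [div_lt_iff₀ hR1, sub_mul, div_mul_cancel₀ _ hR1.ne']
    exact hlt
  change risk F b / (risk F b + 1) - _ ≤ _ at h1
  linarith

/-- Uniform relative lower deviations of the empirical risk. -/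
theorem IsLinearModel.measure_exists_empRisk_lt_le [IsProbabilityMeasure F]
    (h : IsLinearModel F β)
    (hpos : 0 < minEigenvalue (popGram_isHermitian F)) {q τ : ℝ}
    (hq : 1 < q) (hτ : 0 < τ) (htail : TailRatioLE q τ F) {K t : ℝ} (hK : 0 < K) (ht : 0 < t)
    {n : ℕ} (hn : 1 ≤ n) :
    (Measure.pi fun _ : Fin n => F)
        {z | ∃ b, empRisk z b
          < risk F b - ((K ^ 2) ^ (1 - q) * τ ^ q + t) * (risk F b + 1)}
      ≤ ENNReal.ofReal (4 * K * Real.sqrt ((p + 1) / n) / t) := by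
  classical
  set bad : Coef p → (Fin n → Obs p) → Prop := fun b z => empRisk z b
          < risk F b - ((K ^ 2) ^ (1 - q) * τ ^ q + t) * (risk F b + 1) with hbad
  set u := TopologicalSpace.denseSeq (Coef p)
  -- Being bad is an open condition on b, so it is witnessed on a dense sequence. The finite bound
  -- does not depend on T and passes to the increasing union.
  have h1 : {z | ∃ b, bad b z} ⊆
      ⋃ N : ℕ, {z | ∃ b ∈ (Finset.range N).image u, bad b z} := by
    rintro z ⟨b, hb⟩
    have hopen : IsOpen {b | bad b z} := isOpen_lt (continuous_empRisk z)
      (h.continuous_risk.sub (continuous_const.mul (h.continuous_risk.add continuous_const)))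
    obtain ⟨N, hN⟩ := (TopologicalSpace.denseRange_denseSeq (Coef p)).exists_mem_open hopen ⟨b, hb⟩
    exact Set.mem_iUnion.mpr ⟨N + 1, u N, Finset.mem_image_of_mem _ (by simp), hN⟩
  have hmono : Monotone fun N : ℕ => {z | ∃ b ∈ (Finset.range N).image u, bad b z} := by
    rintro N N' hN z ⟨b, hb, hz⟩
    exact ⟨b, Finset.image_subset_image (Finset.range_mono hN) hb, hz⟩
  refine (measure_mono h1).trans ?_
  rw [hmono.measure_iUnion]
  exact iSup_le fun N => h.measure_exists_mem_empRisk_lt_le hpos hq hτ htail hK ht hn _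

/-- Upper deviations of the empirical risk of a fixed predictor. -/
theorem IsLinearModel.measure_lt_empRisk_le [IsProbabilityMeasure F]
    (h : IsLinearModel F β)
    (hpos : 0 < minEigenvalue (popGram_isHermitian F)) {q τ : ℝ}
    (hq : 1 < q) (hτ : 0 < τ) (htail : TailRatioLE q τ F) {K t : ℝ} (hK : 0 < K) (ht : 0 < t)
    {n : ℕ} (hn : 1 ≤ n) (b : Coef p) :
    (Measure.pi fun _ : Fin n => F)
        {z | risk F b + 2 * t * (risk F b + 1) < empRisk z b}
      ≤ ENNReal.ofReal (4 * K * Real.sqrt ((p + 1) / n) / t)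
        + ENNReal.ofReal ((K ^ 2) ^ (1 - q) * τ ^ q / t) := by
  have hn' : (0 : ℝ) < n := by exact_mod_cast hn
  set P := Measure.pi fun _ : Fin n => F
  obtain ⟨ψ, hψ, hD, hc⟩ := h.exists_whitening hpos
  obtain ⟨c, hc1, hc2⟩ := hc b
  have hR := risk_nonneg F b
  have hR1 : 0 < risk F b + 1 := by linarith
  set tr : Obs p → ℝ := fun z => truncSq K (disturbance b z / Real.sqrt (risk F b + 1)) with htr
  set ex : Obs p → ℝ := fun z => loss b z / (risk F b + 1) - tr z with hex
  -- The loss is its truncation plus an excess, and each part is allowed a deviation t. The excess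
  -- is controlled by Markov's inequality, which works for one predictor at a time.
  have key := measure_exists_empirical_ge_le hψ (φ := fun a => - truncSq K a) (fun a b => by
      rw [neg_sub_neg, abs_sub_comm]; exact truncSq_lipschitz hK a b) (continuous_truncSq K).neg
    (fun a => by rw [abs_neg]; exact abs_truncSq_le K a) {c} (by simpa using hc1) (by positivity)
    (by positivity : (0 : ℝ) < p + 1) hD ht hn
  have hexi : Integrable ex F :=
    ((h.integrable_loss b).div_const _).sub (h.integrable_truncSq K b _)
  have htrle : ∀ z, tr z ≤ loss b z / (risk F b + 1) := fun z => by
    simp only [htr]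
    rw [truncSq, div_pow, Real.sq_sqrt hR1.le]
    exact min_le_left _ _
  have hex0 : ∀ z, 0 ≤ ex z := fun z => sub_nonneg.mpr (htrle z)
  have hei : ∀ i : Fin n, Integrable (fun z : Fin n → Obs p => ex (z i)) P := fun i =>
    (measurePreserving_eval (fun _ : Fin n => F) i).integrable_comp_of_integrable hexi
  have hmarkov : P {z | t ≤ (1 / (n : ℝ)) * ∑ i, ex (z i)}
      ≤ ENNReal.ofReal ((K ^ 2) ^ (1 - q) * τ ^ q / t) := by
    have h1 := mul_meas_ge_le_integral_of_nonneg (μ := P)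
      (f := fun z => (1 / (n : ℝ)) * ∑ i, ex (z i))
      (Eventually.of_forall fun z => mul_nonneg (by positivity)
        (Finset.sum_nonneg fun i _ => hex0 (z i)))
      ((integrable_finsetSum _ fun i _ => hei i).const_mul _) t
    have h2 : ∀ i : Fin n, ∫ z, ex (z i) ∂P = ∫ w, ex w ∂F := fun i =>
      integral_comp_eval (μ := fun _ : Fin n => F) hexi.aestronglyMeasurable
    rw [integral_const_mul, integral_finsetSum _ fun i _ => hei i] at h1
    simp only [h2, Finset.sum_const, Finset.card_univ, Fintype.card_fin, nsmul_eq_mul] at h1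
    rw [← mul_assoc, one_div_mul_cancel hn'.ne', one_mul] at h1
    rw [← ofReal_measureReal]
    refine ENNReal.ofReal_le_ofReal ?_
    rw [le_div_iff₀ ht, mul_comm]
    exact h1.trans (h.integral_excess_le hq hτ htail hK b)
  refine (measure_mono ?_).trans ((measure_union_le _ _).trans (add_le_add
    (key.trans (le_of_eq (by ring_nf))) hmarkov))
  intro z hz
  by_contra hcon
  rw [Set.mem_union, not_or] at hcon
  obtain ⟨hc3, hc4⟩ := hcon
  simp only [Set.mem_ofPred_eq, Finset.mem_singleton, exists_eq_left, hc2, integral_neg,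
    Finset.sum_neg_distrib, not_le] at hc3 hc4 hz
  change -(∫ w, tr w ∂F) - 1 / (n : ℝ) * -∑ i, tr (z i) < t at hc3
  have h5 : ∫ w, tr w ∂F ≤ risk F b / (risk F b + 1) := by
    rw [risk, ← integral_div]
    exact integral_mono (h.integrable_truncSq K b _) ((h.integrable_loss b).div_const _) htrle
  have h6 : empRisk z b / (risk F b + 1)
      = (1 / (n : ℝ)) * ∑ i, tr (z i) + (1 / (n : ℝ)) * ∑ i, ex (z i) := by
    rw [← mul_add, ← Finset.sum_add_distrib, empRisk_eq_sum_loss, mul_div_assoc, Finset.sum_div]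
    simp only [hex, add_sub_cancel]
  have h7 : risk F b / (risk F b + 1) + 2 * t < empRisk z b / (risk F b + 1) := by
    rw [lt_div_iff₀ hR1, add_mul, div_mul_cancel₀ _ hR1.ne']
    exact hz
  linarith

end Truncation

/-- Instance search does not find this through `IsProbabilityMeasure` when the factors of the
product are themselves products. -/
instance sFinite_pi_const {Z : Type*} [MeasurableSpace Z] (F : Measure Z) [IsProbabilityMeasure F]
    (n : ℕ) : SFinite (Measure.pi fun _ : Fin n => F) := by
  have : IsProbabilityMeasure (Measure.pi fun _ : Fin n => F) :=
    Measure.pi.instIsProbabilityMeasure _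
  infer_instance

/-! ### Joint law of the training and test samples -/

section JointLaw

variable {Ω : Type*} [MeasurableSpace Ω] {μ : Measure Ω} {nt ns p : ℕ} {F : Measure (Obs p)}
  {Zt : Fin nt → Ω → Obs p} {Zs : Fin ns → Ω → Obs p}

theorem IsIIDTrainTest.aemeasurable_sample (h : IsIIDTrainTest F Zt Zs μ) :
    AEMeasurable (fun ω => ((fun i => Zt i ω), (fun i => Zs i ω))) μ :=
  (aemeasurable_pi_lambda _ fun i => (h.law_train i).aemeasurable).prodMk
    (aemeasurable_pi_lambda _ fun i => (h.law_test i).aemeasurable)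

theorem IsIIDTrainTest.map_sample [IsProbabilityMeasure μ] [IsProbabilityMeasure F]
    (h : IsIIDTrainTest F Zt Zs μ) :
    μ.map (fun ω => ((fun i => Zt i ω), (fun i => Zs i ω)))
      = (Measure.pi fun _ : Fin nt => F).prod (Measure.pi fun _ : Fin ns => F) := by
  have hlaw : ∀ s : Fin nt ⊕ Fin ns, HasLaw (Sum.elim Zt Zs s) F μ := by
    rintro (i | i)
    · exact h.law_train i
    · exact h.law_test i
  have h1 := (iIndepFun_iff_map_fun_eq_pi_map fun s => (hlaw s).aemeasurable).mp h.indep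
  simp only [(hlaw _).map_eq] at h1
  have h2 := measurePreserving_sumPiEquivProdPi (fun _ : Fin nt ⊕ Fin ns => F)
  rw [← h2.map_eq, ← h1, AEMeasurable.map_map_of_aemeasurable h2.measurable.aemeasurable
    (aemeasurable_pi_lambda _ fun s => (hlaw s).aemeasurable)]
  rfl

/-- An inequality is what holds for an arbitrary set S; the deviation events are never shown to be
measurable. -/
theorem IsIIDTrainTest.measure_train_le [IsProbabilityMeasure μ] [IsProbabilityMeasure F]
    (h : IsIIDTrainTest F Zt Zs μ) (S : Set (Fin nt → Obs p)) :
    μ {ω | (fun i => Zt i ω) ∈ S} ≤ (Measure.pi fun _ : Fin nt => F) S := by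
  refine (Measure.le_map_apply h.aemeasurable_sample (Prod.fst ⁻¹' S)).trans ?_
  rw [h.map_sample]
  refine (Measure.le_map_apply measurable_fst.aemeasurable S).trans ?_
  rw [Measure.map_fst_prod]
  simp

theorem IsIIDTrainTest.measure_test_le [IsProbabilityMeasure μ] [IsProbabilityMeasure F]
    (h : IsIIDTrainTest F Zt Zs μ) (S : Set (Fin ns → Obs p)) :
    μ {ω | (fun i => Zs i ω) ∈ S} ≤ (Measure.pi fun _ : Fin ns => F) S := by
  refine (Measure.le_map_apply h.aemeasurable_sample (Prod.snd ⁻¹' S)).trans ?_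
  rw [h.map_sample]
  refine (Measure.le_map_apply measurable_snd.aemeasurable S).trans ?_
  rw [Measure.map_snd_prod]
  simp

end JointLaw

/-! ### Measurable closed form of OLS -/

section ClosedForm

variable {n p : ℕ}

/-- The closed form of the least squares estimate, for samples with a nonsingular second moment
matrix. -/
noncomputable def olsSolution (z : Fin n → Obs p) : Coef p :=
  WithLp.toLp 2 ((gram z).det⁻¹ •
    ((gram z).adjugate *ᵥ ((1 / (n : ℝ)) • ((fun i => (z i).2) ᵥ* design z))))

theorem continuous_design : Continuous (design : (Fin n → Obs p) → _) := by
  refine continuous_matrix fun i j => ?_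
  simp only [design, Matrix.of_apply]
  fun_prop

theorem continuous_gram : Continuous (gram : (Fin n → Obs p) → _) := by
  unfold gram
  exact (continuous_design.matrix_transpose.matrix_mul continuous_design).fun_const_smul _

/-- A given OLS selection need not be a measurable function of the training sample. This one is,
which allows Tonelli's theorem against the test sample. -/
theorem measurable_olsSolution : Measurable (olsSolution : (Fin n → Obs p) → Coef p) := by
  refine (PiLp.continuous_toLp 2 _).measurable.comp (Measurable.fun_smul ?_ ?_)
  · exact continuous_gram.matrix_det.measurable.inv
  · refine Continuous.measurable ?_
    refine continuous_gram.matrix_adjugate.matrix_mulVec (Continuous.fun_const_smul ?_ _)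
    exact Continuous.matrix_vecMul (by fun_prop) continuous_design

theorem gram_mulVec_olsSolution {z : Fin n → Obs p} (hdet : (gram z).det ≠ 0) :
    gram z *ᵥ (olsSolution z).ofLp = (1 / (n : ℝ)) • ((fun i => (z i).2) ᵥ* design z) := by
  rw [olsSolution, mulVec_smul, mulVec_mulVec, mul_adjugate, smul_mulVec, one_mulVec, smul_smul,
    inv_mul_cancel₀ hdet, one_smul]

theorem resid_olsSolution_vecMul_design (hn : 1 ≤ n) {z : Fin n → Obs p}
    (hdet : (gram z).det ≠ 0) : resid z (olsSolution z) ᵥ* design z = 0 := by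
  have hn' : (1 / (n : ℝ)) ≠ 0 := by
    have : (0 : ℝ) < n := by exact_mod_cast hn
    positivity
  have h1 := gram_mulVec_olsSolution hdet
  rw [gram, smul_mulVec] at h1
  have h2 := smul_right_injective _ hn' h1
  have h3 : resid z (olsSolution z)
      = (fun i => (z i).2) - design z *ᵥ (olsSolution z).ofLp := rfl
  rw [h3, sub_vecMul, ← h2, ← mulVec_mulVec, mulVec_transpose, sub_self]

/-- The normal equations remove the cross term, so any other vector has strictly larger empirical
risk. -/
theorem IsOLS.eq_olsSolution (hn : 1 ≤ n) {z : Fin n → Obs p} {b : Coef p} (h : IsOLS z b)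
    (hpd : ∀ v : Coef p, v ≠ 0 → 0 < v.ofLp ⬝ᵥ (gram z *ᵥ v.ofLp)) : b = olsSolution z := by
  have hn' : (0 : ℝ) < n := by exact_mod_cast hn
  have hdet : (gram z).det ≠ 0 := by
    intro h0
    obtain ⟨v, hv, hv0⟩ := exists_mulVec_eq_zero_iff.mpr h0
    have := hpd (WithLp.toLp 2 v) (by simpa using hv)
    simp [hv0] at this
  by_contra hne
  have h1 := hpd (olsSolution z - b) (sub_ne_zero.mpr (Ne.symm hne))
  rw [quadraticForm_gram] at h1
  have h2 := h (olsSolution z)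
  rw [empRisk, empRisk, sum_resid_sq_expand z (olsSolution z) b,
    resid_olsSolution_vecMul_design hn hdet, zero_dotProduct] at h2
  linarith

end ClosedForm

/-! ### Error bounds outside the deviation events -/

section Consistency

variable {p : ℕ} {F : Measure (Obs p)} {β : Coef p}

/-- Samples for which some empirical risk is much smaller than the population risk. -/
def lowerDeviation (F : Measure (Obs p)) (n : ℕ) (η : ℝ) : Set (Fin n → Obs p) :=
  {z | ∃ b, empRisk z b < risk F b - η * (risk F b + 1)}

/-- Samples for which the empirical risk of `β` is much larger than its population risk. -/
def upperDeviation (F : Measure (Obs p)) (β : Coef p) (n : ℕ) (η : ℝ) : Set (Fin n → Obs p) :=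
  {z | risk F β + η * (risk F β + 1) < empRisk z β}

theorem le_empRisk_of_notMem_lowerDeviation {n : ℕ} {η : ℝ} {z : Fin n → Obs p}
    (h : z ∉ lowerDeviation F n η) (b : Coef p) :
    risk F b - η * (risk F b + 1) ≤ empRisk z b :=
  not_lt.mp fun hb => h ⟨b, hb⟩

/-- The chain risk b ≲ empRisk b ≤ empRisk β ≲ risk β bounds (1 − η) times the excess by 2η(risk β +
1), and 1 − η ≥ 1/2. -/
theorem IsOLS.excess_le (hF : IsLinearModel F β) {n : ℕ} {η : ℝ} (hη : η ≤ 1 / 2)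
    {z : Fin n → Obs p} {b : Coef p} (h : IsOLS z b) (hl : z ∉ lowerDeviation F n η)
    (hu : z ∉ upperDeviation F β n η) :
    (b - β).ofLp ⬝ᵥ (popGram F *ᵥ (b - β).ofLp) ≤ 4 * η * (risk F β + 1) := by
  have h1 := le_empRisk_of_notMem_lowerDeviation hl b
  have h2 : empRisk z β ≤ risk F β + η * (risk F β + 1) := not_lt.mp hu
  have h3 := h β
  rw [hF.risk_eq b] at h1
  have h4 := hF.quadraticForm_popGram_nonneg (b - β).ofLp
  nlinarith

/-- Along a null direction of the sample form, the empirical risk is constant while the population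
risk is unbounded, which the uniform lower bound forbids. -/
theorem quadraticForm_gram_pos_of_notMem_lowerDeviation (hF : IsLinearModel F β)
    (hpos : 0 < minEigenvalue (popGram_isHermitian F)) {n : ℕ} (hn : 1 ≤ n) {η : ℝ} (hη : η < 1)
    {z : Fin n → Obs p} (hl : z ∉ lowerDeviation F n η) (v : Coef p) (hv : v ≠ 0) :
    0 < v.ofLp ⬝ᵥ (gram z *ᵥ v.ofLp) := by
  have hn' : (0 : ℝ) < n := by exact_mod_cast hn
  rw [quadraticForm_gram]
  by_contra hcon
  have hsum : ∑ i, ((z i).1 ⬝ᵥ v.ofLp) ^ 2 = 0 := by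
    refine le_antisymm ?_ (Finset.sum_nonneg fun i _ => sq_nonneg _)
    by_contra h
    exact hcon (mul_pos (by positivity) (not_le.mp h))
  have hz : ∀ i, (z i).1 ⬝ᵥ v.ofLp = 0 := fun i =>
    pow_eq_zero_iff (two_ne_zero) |>.mp
      ((Finset.sum_eq_zero_iff_of_nonneg fun i _ => sq_nonneg _).mp hsum i (Finset.mem_univ i))
  set Q := v.ofLp ⬝ᵥ (popGram F *ᵥ v.ofLp) with hQ
  have hQ0 : 0 < Q := lt_of_lt_of_le (by positivity)
    (minEigenvalue_mul_norm_sq_le (popGram_isHermitian F) v)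
  have hη' : 0 < 1 - η := by linarith
  have he : 0 ≤ empRisk z β := mul_nonneg (by positivity)
    (Finset.sum_nonneg fun i _ => sq_nonneg _)
  -- A step √N along v raises (1 − η) risk by empRisk β + 1, just enough for a contradiction.
  set N := (empRisk z β + 1) / ((1 - η) * Q) with hN
  have hN0 : 0 ≤ N := by positivity
  have h1 := le_empRisk_of_notMem_lowerDeviation hl (β + Real.sqrt N • v)
  have h2 : empRisk z (β + Real.sqrt N • v) = empRisk z β := by
    rw [empRisk_eq_sum_loss, empRisk_eq_sum_loss]
    congr 1
    refine Finset.sum_congr rfl fun i _ => ?_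
    simp [loss, dotProduct_add, dotProduct_smul, hz i]
  rw [h2, hF.risk_eq, add_sub_cancel_left, WithLp.ofLp_smul, mulVec_smul, smul_dotProduct,
    dotProduct_smul, smul_smul, Real.mul_self_sqrt hN0, ← hQ, smul_eq_mul] at h1
  have h3 : (1 - η) * (N * Q) = empRisk z β + 1 := by
    rw [hN]; field_simp
  nlinarith [risk_nonneg F β, mul_nonneg hη'.le (risk_nonneg F β)]

theorem IsValidatedLasso.excess_le (hF : IsLinearModel F β) {nt ns : ℕ} {η : ℝ} (hη0 : 0 < η)
    (hη : η ≤ 1 / 2) {zt : Fin nt → Obs p} {zs : Fin ns → Obs p} {Lam : Set ℝ} {bt bl : Coef p}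
    (h : IsValidatedLasso zt zs Lam bt bl)
    (hl : zs ∉ lowerDeviation F ns η) (hu : zs ∉ upperDeviation F β ns η)
    (hD : (bt - β).ofLp ⬝ᵥ (gram zs *ᵥ (bt - β).ofLp) ≤ η ^ 2) :
    (bl - β).ofLp ⬝ᵥ (popGram F *ᵥ (bl - β).ofLp) ≤ 8 * η * (risk F β + 1) := by
  have h1 := le_empRisk_of_notMem_lowerDeviation hl bl
  have h2 : empRisk zs β ≤ risk F β + η * (risk F β + 1) := not_lt.mp hu
  have h3 := h.empRisk_le
  -- Young's inequality (a − c)² ≤ (1 + η)a² + (1 + η⁻¹)c²; the bound η² in `hD` makes the last term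
  -- only η² + η.
  have h4 : empRisk zs bt ≤ (1 + η) * empRisk zs β + (1 + η⁻¹) * η ^ 2 := by
    refine le_trans ?_ (add_le_add_right (mul_le_mul_of_nonneg_left hD (by positivity)) _)
    have he : (1 + η) * empRisk zs β + (1 + η⁻¹) * ((bt - β).ofLp ⬝ᵥ (gram zs *ᵥ (bt - β).ofLp))
        = (1 / (ns : ℝ)) * ∑ i, ((1 + η) * loss β (zs i)
          + (1 + η⁻¹) * ((zs i).1 ⬝ᵥ (bt - β).ofLp) ^ 2) := by
      rw [quadraticForm_gram, empRisk_eq_sum_loss, Finset.sum_add_distrib, ← Finset.mul_sum,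
        ← Finset.mul_sum]
      ring
    rw [he, empRisk_eq_sum_loss]
    refine mul_le_mul_of_nonneg_left (Finset.sum_le_sum fun i _ => ?_) (by positivity)
    set a := disturbance β (zs i)
    set c := (zs i).1 ⬝ᵥ (bt - β).ofLp
    have h5 : loss bt (zs i) = (a - c) ^ 2 := by
      simp only [a, c, loss, disturbance, WithLp.ofLp_sub, dotProduct_sub]
      ring
    rw [h5, show loss β (zs i) = a ^ 2 from rfl]
    have h6 : (1 + η) * a ^ 2 + (1 + η⁻¹) * c ^ 2 - (a - c) ^ 2 = η⁻¹ * (η * a + c) ^ 2 := by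
      field_simp
      ring
    have h7 : 0 ≤ η⁻¹ * (η * a + c) ^ 2 := by positivity
    linarith
  have h8 : (1 + η⁻¹) * η ^ 2 = η ^ 2 + η := by field_simp
  rw [h8] at h4
  rw [hF.risk_eq bl] at h1
  have h9 := hF.quadraticForm_popGram_nonneg (bl - β).ofLp
  have h10 := mul_le_mul_of_nonneg_left h2 (by linarith : 0 ≤ 1 + η)
  have h11 := risk_nonneg F β
  have h12 : η ^ 2 ≤ η / 2 := by nlinarith
  have h13 : η ^ 2 * risk F β ≤ η / 2 * risk F β := mul_le_mul_of_nonneg_right h12 h11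
  nlinarith

/-- An estimation error that is independent of the test sample has a small test quadratic form
when its population quadratic form is small. -/
theorem measure_cross_le [IsProbabilityMeasure F] (hF : IsLinearModel F β) {X : Type*}
    [MeasurableSpace X]
    {P : Measure X} [IsProbabilityMeasure P] {ns : ℕ} (hns : 1 ≤ ns) {d : X → Coef p}
    (hd : Measurable d) {a t : ℝ} (ht : 0 < t) :
    (P.prod (Measure.pi fun _ : Fin ns => F))
      {w | (d w.1).ofLp ⬝ᵥ (popGram F *ᵥ (d w.1).ofLp) ≤ a ∧
        t < (d w.1).ofLp ⬝ᵥ (gram w.2 *ᵥ (d w.1).ofLp)} ≤ ENNReal.ofReal (a / t) := by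
  have hn' : (0 : ℝ) < ns := by exact_mod_cast hns
  set G : Set X := {x | (d x).ofLp ⬝ᵥ (popGram F *ᵥ (d x).ofLp) ≤ a}
  have hG : MeasurableSet G :=
    measurableSet_le ((continuous_quadraticForm (popGram F)).measurable.comp hd) measurable_const
  -- Restricted to the training samples in G, the test form integrates over the test sample to the
  -- population form, at most a; Markov's inequality concludes.
  set g : X × (Fin ns → Obs p) → ENNReal := fun w => G.indicator (fun _ => 1) w.1 *
    ENNReal.ofReal ((d w.1).ofLp ⬝ᵥ (gram w.2 *ᵥ (d w.1).ofLp)) with hg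
  have hcont : Continuous fun w : Coef p × (Fin ns → Obs p) =>
      w.1.ofLp ⬝ᵥ (gram w.2 *ᵥ w.1.ofLp) := by
    have h1 : Continuous fun w : Coef p × (Fin ns → Obs p) => w.1.ofLp := by fun_prop
    exact h1.dotProduct ((continuous_gram.comp continuous_snd).matrix_mulVec h1)
  have hgm : Measurable g :=
    ((measurable_const.indicator hG).comp measurable_fst).mul
      (hcont.measurable.comp ((hd.comp measurable_fst).prodMk measurable_snd)).ennreal_ofReal
  have hinner : ∀ v : Coef p, ∫⁻ z, ENNReal.ofReal (v.ofLp ⬝ᵥ (gram z *ᵥ v.ofLp))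
      ∂(Measure.pi fun _ : Fin ns => F)
      = ENNReal.ofReal (v.ofLp ⬝ᵥ (popGram F *ᵥ v.ofLp)) := by
    intro v
    have hi : Integrable (fun z : Obs p => (z.1 ⬝ᵥ v.ofLp) ^ 2) F :=
      (hF.memLp_dotProduct _).integrable_sq
    have hei : ∀ i : Fin ns, Integrable (fun z : Fin ns → Obs p => ((z i).1 ⬝ᵥ v.ofLp) ^ 2)
        (Measure.pi fun _ : Fin ns => F) := fun i =>
      (measurePreserving_eval (fun _ : Fin ns => F) i).integrable_comp_of_integrable hi
    have h2 : ∀ i : Fin ns, ∫ z, ((z i).1 ⬝ᵥ v.ofLp) ^ 2 ∂(Measure.pi fun _ : Fin ns => F)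
        = v.ofLp ⬝ᵥ (popGram F *ᵥ v.ofLp) := fun i =>
      (integral_comp_eval (μ := fun _ : Fin ns => F) (f := fun z : Obs p => (z.1 ⬝ᵥ v.ofLp) ^ 2)
        hi.aestronglyMeasurable).trans (hF.integral_dotProduct_sq _)
    simp only [quadraticForm_gram]
    rw [← ofReal_integral_eq_lintegral_ofReal
      ((integrable_finsetSum _ fun i _ => hei i).const_mul _)
      (Eventually.of_forall fun z => mul_nonneg (by positivity)
        (Finset.sum_nonneg fun i _ => sq_nonneg _)),
      integral_const_mul, integral_finsetSum _ fun i _ => hei i]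
    simp only [h2, Finset.sum_const, Finset.card_univ, Fintype.card_fin, nsmul_eq_mul]
    rw [← mul_assoc, one_div_mul_cancel hn'.ne', one_mul]
  have hint : ∫⁻ w, g w ∂(P.prod (Measure.pi fun _ : Fin ns => F)) ≤ ENNReal.ofReal a := by
    rw [lintegral_prod _ hgm.aemeasurable]
    calc _ ≤ ∫⁻ _, ENNReal.ofReal a ∂P := by
          refine lintegral_mono fun x => ?_
          by_cases hx : x ∈ G
          · simp only [hg, Set.indicator_of_mem hx, one_mul, hinner]
            exact ENNReal.ofReal_le_ofReal hx
          · simp [hg, Set.indicator_of_notMem hx]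
      _ = _ := by simp
  have hmarkov := mul_meas_ge_le_lintegral₀ (hgm.aemeasurable
    (μ := P.prod (Measure.pi fun _ : Fin ns => F))) (ENNReal.ofReal t)
  rw [ENNReal.ofReal_div_of_pos ht]
  rw [ENNReal.le_div_iff_mul_le (Or.inl (by simpa using ht)) (Or.inl ENNReal.ofReal_ne_top),
    mul_comm]
  refine le_trans ?_ (hmarkov.trans hint)
  refine mul_le_mul' le_rfl (measure_mono ?_)
  rintro w ⟨hw1, hw2⟩
  change ENNReal.ofReal t ≤ g w
  rw [hg]
  simp only [Set.indicator_of_mem (show w.1 ∈ G from hw1), one_mul]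
  exact ENNReal.ofReal_le_ofReal hw2.le

theorem norm_lt_of_quadraticForm_lt {A : Matrix (Fin p) (Fin p) ℝ} (hA : A.IsHermitian)
    {ρ δ : ℝ} (hρ : 0 < ρ) (hρA : ρ ≤ minEigenvalue hA) (hδ : 0 < δ) {v : Coef p}
    (h : v.ofLp ⬝ᵥ (A *ᵥ v.ofLp) < ρ * δ ^ 2) : ‖v‖ < δ := by
  have h1 := minEigenvalue_mul_norm_sq_le hA v
  have h2 := mul_le_mul_of_nonneg_right hρA (sq_nonneg ‖v‖)
  have h3 : ‖v‖ ^ 2 < δ ^ 2 := lt_of_mul_lt_mul_left ((h2.trans h1).trans_lt h) hρ.le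
  exact lt_of_pow_lt_pow_left₀ 2 hδ.le h3

variable {Ω : Type*} [MeasurableSpace Ω] {μ : Measure Ω} [IsProbabilityMeasure μ] {nt ns : ℕ}
  {Zt : Fin nt → Ω → Obs p} {Zs : Fin ns → Ω → Obs p} {bTrain bLasso : Ω → Coef p}
  {Lam : Ω → Set ℝ}

theorem measure_ols_error_le [IsProbabilityMeasure F] (hF : IsLinearModel F β)
    (hiid : IsIIDTrainTest F Zt Zs μ) (hOLS : ∀ᵐ ω ∂μ, IsOLS (fun i => Zt i ω) (bTrain ω))
    {ρ η δ : ℝ} (hρ : 0 < ρ) (hρA : ρ ≤ minEigenvalue (popGram_isHermitian F))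
    (hη : η ≤ 1 / 2) (hδ : 0 < δ) (hηδ : 4 * η * (risk F β + 1) < ρ * δ ^ 2) :
    μ {ω | δ ≤ ‖bTrain ω - β‖} ≤ (Measure.pi fun _ : Fin nt => F) (lowerDeviation F nt η)
      + (Measure.pi fun _ : Fin nt => F) (upperDeviation F β nt η) := by
  have hsub : {ω | δ ≤ ‖bTrain ω - β‖} ≤ᵐ[μ] ({ω | (fun i => Zt i ω) ∈ lowerDeviation F nt η}
      ∪ {ω | (fun i => Zt i ω) ∈ upperDeviation F β nt η} : Set Ω) := by
    filter_upwards [hOLS] with ω hω hδω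
    by_contra hcon
    change ω ∉ (_ ∪ _ : Set Ω) at hcon
    rw [Set.mem_union, not_or] at hcon
    exact (norm_lt_of_quadraticForm_lt (popGram_isHermitian F) hρ hρA hδ
      ((hω.excess_le hF hη hcon.1 hcon.2).trans_lt hηδ)).not_ge hδω
  exact (measure_mono_ae hsub).trans ((measure_union_le _ _).trans
    (add_le_add (hiid.measure_train_le _) (hiid.measure_train_le _)))

/-- Two tolerances are needed: the training level η' must be small relative to η², because the cross
event has probability of order η'/η². -/
theorem measure_lasso_error_le [IsProbabilityMeasure F] (hF : IsLinearModel F β)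
    (hnt : 1 ≤ nt) (hns : 1 ≤ ns)
    (hiid : IsIIDTrainTest F Zt Zs μ) (hOLS : ∀ᵐ ω ∂μ, IsOLS (fun i => Zt i ω) (bTrain ω))
    (hLasso : ∀ᵐ ω ∂μ, IsValidatedLasso (fun i => Zt i ω) (fun i => Zs i ω) (Lam ω)
      (bTrain ω) (bLasso ω))
    {ρ η η' δ : ℝ} (hρ : 0 < ρ) (hρA : ρ ≤ minEigenvalue (popGram_isHermitian F)) (hη0 : 0 < η)
    (hη : η ≤ 1 / 2) (hη' : η' ≤ 1 / 2) (hδ : 0 < δ)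
    (hηδ : 8 * η * (risk F β + 1) < ρ * δ ^ 2) :
    μ {ω | δ ≤ ‖bLasso ω - β‖} ≤
      (((Measure.pi fun _ : Fin nt => F) (lowerDeviation F nt η')
      + (Measure.pi fun _ : Fin nt => F) (upperDeviation F β nt η'))
      + ((Measure.pi fun _ : Fin ns => F) (lowerDeviation F ns η)
      + (Measure.pi fun _ : Fin ns => F) (upperDeviation F β ns η)))
      + ENNReal.ofReal (4 * η' * (risk F β + 1) / η ^ 2) := by
  set cross : Set ((Fin nt → Obs p) × (Fin ns → Obs p)) :=
    {w | (olsSolution w.1 - β).ofLp ⬝ᵥ (popGram F *ᵥ (olsSolution w.1 - β).ofLp)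
        ≤ 4 * η' * (risk F β + 1) ∧
      η ^ 2 < (olsSolution w.1 - β).ofLp ⬝ᵥ (gram w.2 *ᵥ (olsSolution w.1 - β).ofLp)}
  have hsub : {ω | δ ≤ ‖bLasso ω - β‖} ≤ᵐ[μ]
      ((({ω | (fun i => Zt i ω) ∈ lowerDeviation F nt η'}
      ∪ {ω | (fun i => Zt i ω) ∈ upperDeviation F β nt η'})
      ∪ ({ω | (fun i => Zs i ω) ∈ lowerDeviation F ns η}
      ∪ {ω | (fun i => Zs i ω) ∈ upperDeviation F β ns η}))
      ∪ {ω | ((fun i => Zt i ω), (fun i => Zs i ω)) ∈ cross} : Set Ω) := by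
    filter_upwards [hOLS, hLasso] with ω hω hω' hδω
    by_contra hcon
    change ω ∉ (_ ∪ _ : Set Ω) at hcon
    simp only [Set.mem_union, not_or] at hcon
    obtain ⟨⟨⟨h1, h2⟩, h3, h4⟩, h5⟩ := hcon
    -- Outside the training events `bTrain` is the measurable closed form, so the cross estimate
    -- applies.
    have heq := hω.eq_olsSolution hnt (quadraticForm_gram_pos_of_notMem_lowerDeviation hF
      (hρ.trans_le hρA) hnt (by linarith) h1)
    have hex := hω.excess_le hF hη' h1 h2
    have hD : (bTrain ω - β).ofLp ⬝ᵥ (gram (fun i => Zs i ω) *ᵥ (bTrain ω - β).ofLp) ≤ η ^ 2 := by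
      rw [heq] at hex ⊢
      exact not_lt.mp fun hlt => h5 ⟨hex, hlt⟩
    exact (norm_lt_of_quadraticForm_lt (popGram_isHermitian F) hρ hρA hδ
      ((hω'.excess_le hF hη0 hη h3 h4 hD).trans_lt hηδ)).not_ge hδω
  have hcross : μ {ω | ((fun i => Zt i ω), (fun i => Zs i ω)) ∈ cross}
      ≤ ENNReal.ofReal (4 * η' * (risk F β + 1) / η ^ 2) := by
    refine (Measure.le_map_apply hiid.aemeasurable_sample cross).trans ?_
    rw [hiid.map_sample]
    exact measure_cross_le hF hns (d := fun z => olsSolution z - β)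
      (measurable_olsSolution.sub measurable_const)
      (by positivity)
  refine (measure_mono_ae hsub).trans ((measure_union_le _ _).trans (add_le_add ?_ hcross))
  refine (measure_union_le _ _).trans (add_le_add ?_ ?_)
  · exact (measure_union_le _ _).trans
      (add_le_add (hiid.measure_train_le _) (hiid.measure_train_le _))
  · exact (measure_union_le _ _).trans
      (add_le_add (hiid.measure_test_le _) (hiid.measure_test_le _))

end Consistency

/-! ### Limits along the sequence -/

theorem exists_truncation_level {q τ ε : ℝ} (hq : 1 < q) (hτ : 0 < τ) (hε : 0 < ε) :
    ∃ K : ℝ, 0 < K ∧ (K ^ 2) ^ (1 - q) * τ ^ q = ε := by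
  have hτq : 0 < τ ^ q := Real.rpow_pos_of_pos hτ q
  have hM : 0 < (ε / τ ^ q) ^ (1 - q)⁻¹ := by positivity
  refine ⟨Real.sqrt ((ε / τ ^ q) ^ (1 - q)⁻¹), Real.sqrt_pos.mpr hM, ?_⟩
  rw [Real.sq_sqrt hM.le, Real.rpow_inv_rpow (by positivity) (by linarith)]
  field_simp

theorem tendsto_zero_of_forall_le_add {u : ℕ → ENNReal}
    (h : ∀ ε : ℝ, 0 < ε → ∃ v : ℕ → ENNReal, Tendsto v atTop (𝓝 0) ∧
      ∀ k, u k ≤ v k + ENNReal.ofReal ε) : Tendsto u atTop (𝓝 0) := by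
  rw [ENNReal.tendsto_nhds_zero]
  intro ε hε
  obtain ⟨ε', hε'0, hε'⟩ := ENNReal.lt_iff_exists_real_btwn.mp hε
  have hpos : 0 < ε' := by
    rw [← ENNReal.ofReal_pos]; exact hε'.1
  obtain ⟨v, hv, huv⟩ := h (ε' / 2) (by linarith)
  filter_upwards [(ENNReal.tendsto_nhds_zero.mp hv) (ENNReal.ofReal (ε' / 2))
    (ENNReal.ofReal_pos.mpr (by linarith))] with k hk
  calc u k ≤ v k + ENNReal.ofReal (ε' / 2) := huv k
    _ ≤ ENNReal.ofReal (ε' / 2) + ENNReal.ofReal (ε' / 2) := by gcongr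
    _ = ENNReal.ofReal ε' := by
      rw [← ENNReal.ofReal_add (by linarith) (by linarith), add_halves]
    _ ≤ ε := hε'.2.le

section Sequences

variable {p n : ℕ → ℕ} {F : ∀ k, Measure (Obs (p k))} [∀ k, IsProbabilityMeasure (F k)]
  {β : ∀ k, Coef (p k)}

theorem tendsto_deviation_bound (hp : ∀ k, 1 ≤ p k)
    (hpn : Tendsto (fun k => (p k : ℝ) / n k) atTop (𝓝 0)) (K t : ℝ) :
    Tendsto (fun k => ENNReal.ofReal (4 * K * Real.sqrt ((p k + 1) / n k) / t)) atTop (𝓝 0) := by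
  have h1 : Tendsto (fun k => ((p k : ℝ) + 1) / n k) atTop (𝓝 0) := by
    refine squeeze_zero (fun k => by positivity) (fun k => ?_)
      (by simpa using hpn.const_mul 2 : Tendsto (fun k => 2 * ((p k : ℝ) / n k)) atTop (𝓝 0))
    rw [← mul_div_assoc]
    have : (1 : ℝ) ≤ p k := by exact_mod_cast hp k
    gcongr
    linarith
  have h2 := (((Real.continuous_sqrt.tendsto 0).comp h1).const_mul (4 * K)).div_const t
  simp only [Real.sqrt_zero, mul_zero, zero_div] at h2
  simpa using ENNReal.tendsto_ofReal h2

theorem tendsto_lowerDeviation (hF : ∀ k, IsLinearModel (F k) (β k))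
    (hpos : ∀ k, 0 < minEigenvalue (popGram_isHermitian (F k))) {q τ : ℝ} (hq : 1 < q) (hτ : 0 < τ)
    (htail : ∀ k, TailRatioLE q τ (F k)) (hp : ∀ k, 1 ≤ p k) (hn : ∀ k, 1 ≤ n k)
    (hpn : Tendsto (fun k => (p k : ℝ) / n k) atTop (𝓝 0)) {η : ℝ} (hη : 0 < η) :
    Tendsto (fun k => (Measure.pi fun _ : Fin (n k) => F k) (lowerDeviation (F k) (n k) η))
      atTop (𝓝 0) := by
  -- K depends on q, τ and η but not on k; the excess uses one half of η and the process the other.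
  obtain ⟨K, hK, hKη⟩ := exists_truncation_level hq hτ (half_pos hη)
  refine tendsto_of_tendsto_of_tendsto_of_le_of_le tendsto_const_nhds
    (tendsto_deviation_bound hp hpn K (η / 2)) (fun _ => zero_le) fun k => ?_
  have := (hF k).measure_exists_empRisk_lt_le (hpos k) hq hτ (htail k) hK (half_pos hη) (hn k)
  rwa [hKη, add_halves] at this

theorem tendsto_upperDeviation (hF : ∀ k, IsLinearModel (F k) (β k))
    (hpos : ∀ k, 0 < minEigenvalue (popGram_isHermitian (F k))) {q τ : ℝ} (hq : 1 < q) (hτ : 0 < τ)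
    (htail : ∀ k, TailRatioLE q τ (F k)) (hp : ∀ k, 1 ≤ p k) (hn : ∀ k, 1 ≤ n k)
    (hpn : Tendsto (fun k => (p k : ℝ) / n k) atTop (𝓝 0)) {η : ℝ} (hη : 0 < η) :
    Tendsto (fun k => (Measure.pi fun _ : Fin (n k) => F k) (upperDeviation (F k) (β k) (n k) η))
      atTop (𝓝 0) := by
  refine tendsto_zero_of_forall_le_add fun ε hε => ?_
  have ht : 0 < η / 2 := half_pos hη
  -- The Markov term does not vanish as k grows, so K is chosen to make it equal to ε.
  obtain ⟨K, hK, hKε⟩ := exists_truncation_level hq hτ (mul_pos hε ht)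
  refine ⟨_, tendsto_deviation_bound hp hpn K (η / 2), fun k => ?_⟩
  have := (hF k).measure_lt_empRisk_le (hpos k) hq hτ (htail k) hK ht (hn k) (β k)
  rw [hKε, mul_div_cancel_right₀ _ ht.ne', mul_div_cancel₀ η two_ne_zero] at this
  exact this

end Sequences

end ValidatedLasso

/-! ### Assembly of the two claims -/

theorem theorem3
    {Ω : ℕ → Type*} [∀ k, MeasurableSpace (Ω k)]
    (μ : ∀ k, Measure (Ω k)) [∀ k, IsProbabilityMeasure (μ k)]
    (p nt ns : ℕ → ℕ)
    (hp : ∀ k, 1 ≤ p k) (hns : ∀ k, 1 ≤ ns k) (hnt : ∀ k, p k ≤ nt k)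
    (F : ∀ k, Measure (ValidatedLasso.Obs (p k))) [∀ k, IsProbabilityMeasure (F k)]
    (β : ∀ k, ValidatedLasso.Coef (p k))
    (hmodel : ∀ k, ValidatedLasso.IsLinearModel (F k) (β k))
    (q τ : ℝ) (hq : 1 < q) (hτ : 0 < τ)
    (htail : ∀ k, ValidatedLasso.TailRatioLE q τ (F k))
    (Zt : ∀ k, Fin (nt k) → Ω k → ValidatedLasso.Obs (p k))
    (Zs : ∀ k, Fin (ns k) → Ω k → ValidatedLasso.Obs (p k))
    (hiid : ∀ k, ValidatedLasso.IsIIDTrainTest (F k) (Zt k) (Zs k) (μ k))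
    (Lam : ∀ k, Ω k → Set ℝ)
    (bTrain bLasso : ∀ k, Ω k → ValidatedLasso.Coef (p k))
    (hOLS : ∀ k, ∀ᵐ ω ∂(μ k), ValidatedLasso.IsOLS (fun i => Zt k i ω) (bTrain k ω))
    (hLasso : ∀ k, ∀ᵐ ω ∂(μ k), ValidatedLasso.IsValidatedLasso
      (fun i => Zt k i ω) (fun i => Zs k i ω) (Lam k ω) (bTrain k ω) (bLasso k ω)) :
    -- the finite-sample bound
    (∀ k, ∀ ϖ : ℝ, 0 < ϖ → ϖ < 1 →
      ∃ A : Set (Ω k), MeasurableSet A ∧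
        ENNReal.ofReal (ϖ * (1 - 1 / (nt k : ℝ))) ≤ μ k A ∧
        ∀ ω ∈ A, ∀ ρ : ℝ,
          ρ = ValidatedLasso.minEigenvalue
            (ValidatedLasso.gram_isHermitian (fun i => Zs k i ω)) →
          0 < ρ →
          ‖bTrain k ω - bLasso k ω‖ ≤
            ValidatedLasso.lassoBound (nt k) (ns k) (ValidatedLasso.vcEps (nt k) (p k))
              (ValidatedLasso.varsigma q τ ϖ (ns k) (ValidatedLasso.risk (F k) (bTrain k ω)))
              ρ
              (∑ i, ValidatedLasso.resid (fun i => Zt k i ω) (bTrain k ω) i ^ 2)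
              (∑ i, ValidatedLasso.resid (fun i => Zs k i ω) (bTrain k ω) i ^ 2)
              ‖ValidatedLasso.resid (fun i => Zs k i ω) (bTrain k ω) ᵥ*
                ValidatedLasso.design (fun i => Zs k i ω)‖
              (ValidatedLasso.l1norm (bTrain k ω))) ∧
    -- consistency
    (∀ ρ₀ C : ℝ, 0 < ρ₀ →
      (∀ k, ρ₀ ≤ ValidatedLasso.minEigenvalue (ValidatedLasso.popGram_isHermitian (F k))) →
      (∀ k, ∫ z, z.2 ^ 2 ∂(F k) ≤ C) →
      Tendsto (fun k => (p k : ℝ) / ((min (nt k) (ns k) : ℕ) : ℝ)) atTop (𝓝 0) →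
      ∀ δ : ℝ, 0 < δ →
        Tendsto (fun k => μ k {ω | δ ≤ ‖bTrain k ω - β k‖}) atTop (𝓝 0) ∧
        Tendsto (fun k => μ k {ω | δ ≤ ‖bLasso k ω - β k‖}) atTop (𝓝 0)) := by
  refine ⟨fun k ϖ hϖ0 hϖ1 => ?_, fun ρ₀ C hρ₀ hmin hC hpn => ?_⟩
  · obtain ⟨N, hN, hNm, hN0⟩ := exists_measurable_superset_of_null (ae_iff.mp (hLasso k))
    refine ⟨Nᶜ, hNm.compl, ?_, fun ω hω ρ hρ hρ0 => ?_⟩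
    · rw [(prob_compl_eq_one_iff hNm).mpr hN0, ← ENNReal.ofReal_one]
      refine ENNReal.ofReal_le_ofReal ?_
      have h1 : 1 - 1 / (nt k : ℝ) ≤ 1 := sub_le_self _ (by positivity)
      nlinarith
    · have hv := not_not.mp fun h => hω (hN h)
      rw [hρ] at hρ0
      rw [hρ, ValidatedLasso.lassoBound]
      exact (hv.norm_sub_le (hns k) hρ0).trans
        ((le_add_of_nonneg_left (Real.sqrt_nonneg _)).trans
          (le_add_of_nonneg_right (Real.sqrt_nonneg _)))
  · have hnt1 : ∀ k, 1 ≤ nt k := fun k => (hp k).trans (hnt k)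
    have hratio : ∀ n : ℕ → ℕ, (∀ k, min (nt k) (ns k) ≤ n k) →
        Tendsto (fun k => (p k : ℝ) / n k) atTop (𝓝 0) := fun n hn =>
      squeeze_zero (fun k => by positivity) (fun k => by
        have h1 : (0 : ℝ) < (min (nt k) (ns k) : ℕ) := by
          exact_mod_cast lt_min (hnt1 k) (hns k)
        have h2 : ((min (nt k) (ns k) : ℕ) : ℝ) ≤ n k := by exact_mod_cast hn k
        gcongr) hpn
    have hpt := hratio nt fun k => min_le_left _ _
    have hps := hratio ns fun k => min_le_right _ _
    have hpos : ∀ k, 0 < ValidatedLasso.minEigenvalue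
        (ValidatedLasso.popGram_isHermitian (F k)) := fun k => hρ₀.trans_le (hmin k)
    have hR : ∀ k, ValidatedLasso.risk (F k) (β k) ≤ C := fun k =>
      (hmodel k).risk_le_response.trans (hC k)
    have hC0 : 0 < C + 1 := by
      linarith [ValidatedLasso.risk_nonneg (F 0) (β 0), hR 0]
    have hlow := fun {n : ℕ → ℕ} => ValidatedLasso.tendsto_lowerDeviation (n := n) hmodel hpos hq
      hτ htail hp
    have hup := fun {n : ℕ → ℕ} => ValidatedLasso.tendsto_upperDeviation (n := n) hmodel hpos hq
      hτ htail hp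
    intro δ hδ
    obtain ⟨η, hη0, hη, hηδ⟩ : ∃ η : ℝ, 0 < η ∧ η ≤ 1 / 2 ∧ 8 * η * (C + 1) < ρ₀ * δ ^ 2 := by
      have h0 : 0 < ρ₀ * δ ^ 2 / (16 * (C + 1)) := by positivity
      refine ⟨min (1 / 2) (ρ₀ * δ ^ 2 / (16 * (C + 1))), lt_min (by norm_num) h0,
        min_le_left _ _, ?_⟩
      calc _ ≤ 8 * (ρ₀ * δ ^ 2 / (16 * (C + 1))) * (C + 1) := by
            gcongr
            exact min_le_right _ _
        _ = ρ₀ * δ ^ 2 / 2 := by field_simp; norm_num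
        _ < _ := half_lt_self (by positivity)
    have hηk : ∀ k, 8 * η * (ValidatedLasso.risk (F k) (β k) + 1) < ρ₀ * δ ^ 2 := fun k =>
      lt_of_le_of_lt (by gcongr; exact hR k) hηδ
    have hsum := fun {η' : ℝ} (h : 0 < η') =>
      (hlow hnt1 hpt h).add (hup hnt1 hpt h)
    simp only [add_zero] at hsum
    refine ⟨?_, ValidatedLasso.tendsto_zero_of_forall_le_add fun ε hε => ?_⟩
    · refine tendsto_of_tendsto_of_tendsto_of_le_of_le tendsto_const_nhds (hsum hη0)
        (fun _ => zero_le) fun k => ?_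
      have h1 : 0 ≤ η * (ValidatedLasso.risk (F k) (β k) + 1) :=
        mul_nonneg hη0.le (by linarith [ValidatedLasso.risk_nonneg (F k) (β k)])
      exact ValidatedLasso.measure_ols_error_le (hmodel k) (hiid k) (hOLS k) hρ₀ (hmin k)
        hη hδ (by linarith [hηk k])
    -- This choice makes the cross probability at most ε, uniformly in k.
    · set η' := min (1 / 2) (ε * η ^ 2 / (4 * (C + 1))) with hη'
      have hη'0 : 0 < η' := lt_min (by norm_num) (by positivity)
      have hlim := (hsum hη'0).add ((hlow hns hps hη0).add (hup hns hps hη0))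
      simp only [add_zero] at hlim
      refine ⟨_, hlim, fun k => ?_⟩
      refine (ValidatedLasso.measure_lasso_error_le (hmodel k) (hnt1 k) (hns k) (hiid k) (hOLS k)
        (hLasso k) hρ₀ (hmin k) hη0 hη (min_le_left _ _ : η' ≤ 1 / 2) hδ (hηk k)).trans ?_
      gcongr
      calc 4 * η' * (ValidatedLasso.risk (F k) (β k) + 1) / η ^ 2
          ≤ 4 * (ε * η ^ 2 / (4 * (C + 1))) * (C + 1) / η ^ 2 := by
            gcongr
            · linarith [ValidatedLasso.risk_nonneg (F k) (β k)]
            · exact min_le_right _ _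
            · exact hR k
        _ = ε := by field_simp
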